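/- Work in units with $c=1$. A (coordinate) static spacetime is an open set $\mathbb R\times\Omega$, $\Omega\subseteq\mathbb R^3$, with coordinates $(t,x)$ and a smooth Lorentzian metric $g$ of signature $(-,+,+,+)$ whose components do not depend on $t$, with $g(\partial_t,\partial_t)<0$, $g(\partial_t,\partial_{x^i})=0$, and $\partial_t$ future-pointing. For $L,\varepsilon>0$, a region $V$ is *gently curved on the scale $L$ with bound $\varepsilon$* if on $V$ the metric differs from the Minkowski metric $\eta=-dt^2+|dx|^2$ in norm by at most $\varepsilon$, its first derivatives are at most $\varepsilon/L$ and its second derivatives at most $\varepsilon/L^2$ (in particular the Riemann curvature is $O(\varepsilon/L^2)$). Signals travel along affinely parametrized future-pointing null geodesics that stay in $V$. An open machine in $V$ is a smooth embedding $\gamma:\mathbb R\to V$, $\zeta\mapsto\gamma(\zeta)$ (with $\zeta$ the clock reading) with timelike future-pointing tangent. A reading is written $\zeta=m+\phi$ with $m\in\mathbb Z$ (the cycle count) and $-\tfrac12<\phi\le\tfrac12$ (the phase). Two machines $A,B$ are radar linkable if every event of each is joined to the image of the other by exactly one future-pointing and exactly one past-pointing null geodesic in $V$. The echo count $\Delta_{ABA}$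 at the $A$-reading $m$ is $m'-m$, where $m'$ is the first $A$-reading reached by a signal that $B$ sends back at or after its reception of the signal transmitted by $A$ at $m$. **Proposition.** There is an absolute constant $\varepsilon>0$ such that the following holds for every static spacetime, every $x_0\in\mathbb R^3$, every $p_\tau>0$ and every positive integer $N$. Put $V=\{(t,x): |x-x_0|<2Np_\tau\}$, and suppose that $V$ lies in the spacetime and is gently curved on the scale $Np_\tau$ with bound $\varepsilon$. Then there are four open machines $V_1,V_2,V_3,V_4$ in $V$, each at rest at a fixed spatial coordinate, $V_1$ at $x_0$ and the four positions affinely independent (the vertices of a nondegenerate tetrahedron), such that each clock cycle of $V_1$ lasts the proper time $p_\tau$, and for all $i\ne j$: 1. $V_i$ and $V_j$ are radar linkable in $V$, and signals from $V_i$ to $V_j$ that are sent later arrive later; 2. the signals sent by $V_i$ to $V_j$ at its ticks (null phase) form precisely the channel $\{(k,k+N): k\in\mathbb Z\}$ of pairs (reading at transmission, reading at reception); in particular all phases of this channel are null; 3. the echo count $\Delta_{V_iV_jV_i}$ at every $m\in\mathbb Z$ is $2N$. Thus the four machines are linked, like the vertices of a regular tetrahedron, by six two-way channels with null phases and all echo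 counts equal to $2N$, independently of the gentle curvature. -/

import Mathlib

open Set
open scoped ContDiff

noncomputable section

/-- Spacetime coordinates `(t, x)`: a time coordinate and three space coordinates
(units with speed of light `1`). -/
abbrev Event : Type := ℝ × EuclideanSpace ℝ (Fin 3)

/-- The coordinate vector field `∂/∂t`. -/
def timeDir : Event := (1, 0)

/-- Values of a metric tensor field at an event: (continuous) bilinear forms on tangent vectors. -/
abbrev BilForm : Type := Event →L[ℝ] Event →L[ℝ] ℝ

/-- The Euclidean form `dx² + dy² + dz²` on the space coordinates. -/
def euclideanForm : EuclideanSpace ℝ (Fin 3) →L[ℝ] EuclideanSpace ℝ (Fin 3) →L[ℝ] ℝ := innerSL ℝ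

/-- The Minkowski form `-dt² + dx² + dy² + dz²`. -/
def minkowski : BilForm :=
  euclideanForm.bilinearComp (ContinuousLinearMap.snd ℝ ℝ (EuclideanSpace ℝ (Fin 3)))
      (ContinuousLinearMap.snd ℝ ℝ (EuclideanSpace ℝ (Fin 3)))
    - (ContinuousLinearMap.mul ℝ ℝ).bilinearComp
      (ContinuousLinearMap.fst ℝ ℝ (EuclideanSpace ℝ (Fin 3)))
      (ContinuousLinearMap.fst ℝ ℝ (EuclideanSpace ℝ (Fin 3)))

theorem minkowski_apply (u v : Event) :
    minkowski u v = inner ℝ u.2 v.2 - u.1 * v.1 := by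
  simp only [minkowski, euclideanForm]
  rfl

/-- A spacetime described in coordinates: an open set of events with a smooth Lorentzian metric of
signature `(-,+,+,+)`, time-oriented by declaring the timelike vector field `∂/∂t` to be
future-pointing. -/
structure Spacetime where
  carrier : Set Event
  isOpen_carrier : IsOpen carrier
  metric : Event → BilForm
  smooth : ContDiffOn ℝ ∞ metric carrier
  symm : ∀ p ∈ carrier, ∀ u v, metric p u v = metric p v u
  timelike_timeDir : ∀ p ∈ carrier, metric p timeDir timeDir < 0
  spacelike_orthogonal : ∀ p ∈ carrier, ∀ v, v ≠ 0 → metric p timeDir v = 0 → 0 < metric p v v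

namespace Spacetime

variable (S : Spacetime)

/-- The spacetime is static with respect to its coordinates: the region is invariant under time
translation, the metric components do not depend on `t` (so `∂/∂t` is a Killing field), and
`∂/∂t` is orthogonal to the slices `t = const`. -/
structure IsStatic : Prop where
  carrier_translate : ∀ (s t : ℝ) (x : EuclideanSpace ℝ (Fin 3)),
    (s, x) ∈ S.carrier → (t, x) ∈ S.carrier
  metric_translate : ∀ (s t : ℝ) (x : EuclideanSpace ℝ (Fin 3)),
    (s, x) ∈ S.carrier → S.metric (s, x) = S.metric (t, x)
  orthogonal : ∀ p ∈ S.carrier, ∀ v : EuclideanSpace ℝ (Fin 3), S.metric p timeDir (0, v) = 0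

/-- The region `V` is gently curved on the length scale `L`, with bound `ε`: it lies in the
spacetime, and there the metric differs from the Minkowski form by at most `ε`, its first
derivatives are at most `ε / L` and its second derivatives at most `ε / L ^ 2`. As the Riemann
tensor is an algebraic expression in the metric, its inverse and these derivatives, this makes
`L ^ 2` times the Riemann curvature of order `ε`. -/
def IsGentlyCurved (V : Set Event) (L ε : ℝ) : Prop :=
  V ⊆ S.carrier ∧ ∀ p ∈ V, ∀ k : ℕ, k ≤ 2 →
    ‖iteratedFDeriv ℝ k (fun q => S.metric q - minkowski) p‖ ≤ ε / L ^ k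

/-- `c`, restricted to `[0, 1]`, is an affinely parametrized future-pointing null geodesic from `p`
to `q` that stays in the region `V`. The geodesic equation is written with lowered index,
`g_{ab} c''^b + (∂_d g_{ab}) c'^d c'^b - (1/2) (∂_a g_{bd}) c'^b c'^d = 0`. -/
structure IsNullGeodesic (V : Set Event) (c : ℝ → Event) (p q : Event) : Prop where
  source : c 0 = p
  target : c 1 = q
  mem : ∀ s ∈ Icc (0 : ℝ) 1, c s ∈ V
  smooth : ContDiffOn ℝ 2 c (Icc 0 1)
  null : ∀ s ∈ Icc (0 : ℝ) 1,
    S.metric (c s) (derivWithin c (Icc 0 1) s) (derivWithin c (Icc 0 1) s) = 0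
  future : ∀ s ∈ Icc (0 : ℝ) 1, S.metric (c s) timeDir (derivWithin c (Icc 0 1) s) < 0
  geodesic : ∀ s ∈ Icc (0 : ℝ) 1, ∀ w : Event,
    S.metric (c s) (derivWithin (derivWithin c (Icc 0 1)) (Icc 0 1) s) w
      + fderiv ℝ S.metric (c s) (derivWithin c (Icc 0 1) s) (derivWithin c (Icc 0 1) s) w
      - 1 / 2 *
        fderiv ℝ S.metric (c s) w (derivWithin c (Icc 0 1) s) (derivWithin c (Icc 0 1) s) = 0

/-- A signal can propagate in `V` from the event `p` to the event `q`. -/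
def Signal (V : Set Event) (p q : Event) : Prop :=
  ∃ c : ℝ → Event, S.IsNullGeodesic V c p q

/-- The worldline, in the region `V`, of an open machine whose clock runs through all real
readings: a smooth embedding of the real line of readings with timelike future-pointing tangent. -/
structure IsOpenMachine (V : Set Event) (γ : ℝ → Event) : Prop where
  mem : ∀ ζ, γ ζ ∈ V
  smooth : ContDiff ℝ ∞ γ
  embedding : Topology.IsEmbedding γ
  timelike : ∀ ζ, S.metric (γ ζ) (deriv γ ζ) (deriv γ ζ) < 0
  future : ∀ ζ, S.metric (γ ζ) timeDir (deriv γ ζ) < 0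

/-- Proper time elapsed along `γ` between the clock readings `a` and `b`. -/
def properTime (γ : ℝ → Event) (a b : ℝ) : ℝ :=
  ∫ ζ in a..b, Real.sqrt (-(S.metric (γ ζ) (deriv γ ζ) (deriv γ ζ)))

/-- Each cycle of the clock of `γ` lasts the proper time `pτ`. -/
def HasProperPeriod (γ : ℝ → Event) (pτ : ℝ) : Prop :=
  ∀ ζ : ℝ, S.properTime γ ζ (ζ + 1) = pτ

/-- Every event of `A` in `U` is reached by exactly one future-pointing null geodesic in `V` from
the image of `B`, and by exactly one past-pointing null geodesic in `V` from the image of `B`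
(that is, a future-pointing one from the event to the image of `B`). -/
def UniquelyReached (V U : Set Event) (A B : ℝ → Event) : Prop :=
  ∀ ζ : ℝ, A ζ ∈ U →
    (∃ (η : ℝ) (c : ℝ → Event), S.IsNullGeodesic V c (B η) (A ζ) ∧
      ∀ (η' : ℝ) (c' : ℝ → Event), S.IsNullGeodesic V c' (B η') (A ζ) →
        η' = η ∧ EqOn c' c (Icc 0 1)) ∧
    (∃ (η : ℝ) (c : ℝ → Event), S.IsNullGeodesic V c (A ζ) (B η) ∧
      ∀ (η' : ℝ) (c' : ℝ → Event), S.IsNullGeodesic V c' (A ζ) (B η') →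
        η' = η ∧ EqOn c' c (Icc 0 1))

/-- `A` and `B` are radar linkable in `U` (with null geodesics taken in `V`). -/
def RadarLinkable (V U : Set Event) (A B : ℝ → Event) : Prop :=
  S.UniquelyReached V U A B ∧ S.UniquelyReached V U B A

/-- The pairs (`A`-reading at transmission, `B`-reading at reception) of all signals in `V`
from `A` to `B`. -/
def signalReadings (V : Set Event) (A B : ℝ → Event) : Set (ℝ × ℝ) :=
  {r | S.Signal V (A r.1) (B r.2)}

end Spacetime

/-- The phase of a clock reading `m.φ = m + φ`, with `m` an integer and `-1/2 < φ ≤ 1/2`. -/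
def phase (ζ : ℝ) : ℝ := ζ - (⌈ζ - 1 / 2⌉ : ℤ)

/-- All transmissions and receptions of the channel occur at null phase. -/
def HasNullPhases (C : Set (ℝ × ℝ)) : Prop := ∀ r ∈ C, phase r.1 = 0 ∧ phase r.2 = 0

/-- Of two signals, whichever is sent later arrives later. -/
def PreservesOrder (C : Set (ℝ × ℝ)) : Prop :=
  ∀ r ∈ C, ∀ r' ∈ C, r.1 < r'.1 → r.2 < r'.2

namespace Spacetime

variable (S : Spacetime)

/-- The channel from `A` to `B` formed by all signals that `A` transmits at ticks (null phase),
whatever the phase of their reception. -/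
def tickChannel (V : Set Event) (A B : ℝ → Event) : Set (ℝ × ℝ) :=
  {r | r ∈ S.signalReadings V A B ∧ phase r.1 = 0}

/-- The echo count `Δ_{ABA}` at the `A`-reading `m` exists and equals `Δ`: `A` transmits at `m`,
`B` receives at some reading `b`, and among the signals that `B` can transmit back at or after `b`
the first one to reach `A` does so at the `A`-reading `m + Δ`. -/
def HasEchoCount (V : Set Event) (A B : ℝ → Event) (m : ℝ) (Δ : ℝ) : Prop :=
  ∃ b : ℝ, (m, b) ∈ S.signalReadings V A B ∧
    IsLeast {a : ℝ | ∃ b' : ℝ, b ≤ b' ∧ (b', a) ∈ S.signalReadings V B A} (m + Δ)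

end Spacetime

/-- The world tube `{(t, x) | |x - x₀| < R}` around the coordinate line `x = x₀`. -/
def worldTube (x₀ : EuclideanSpace ℝ (Fin 3)) (R : ℝ) : Set Event :=
  {p | p.2 ∈ Metric.ball x₀ R}

end

/-! Put R = N·pτ and x = x₀ + Rξ, so that the region becomes the ball |ξ| < 2. A static metric
splits into a squared lapse f and a space metric h. Along an affinely parametrized null geodesic the
energy P = f·t' is conserved, and eliminating t' by the null condition leaves an equation for the
space part alone, ⟨q, ·⟩ + Λ = 0, with q the acceleration and Λ = `forceForm` of order ε. Its
solutions are called rays.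

Since Λ is O(ε) both in size and in Lipschitz constant, the boundary value problem for rays is a
contraction in q (`exists_isRay`), and rays depend on their endpoints uniquely and Lipschitz
continuously (`IsRay.norm_acceleration_sub_le`). Uniqueness has to cover every null geodesic in V,
hence the a priori bound `IsRay.norm_velocity_le`: a very fast ray would run almost straight out of
the ball.

Light therefore takes the coordinate time R√Θ(a, b) from a to b. Rays can be reversed, so Θ is
symmetric; and Θ(a, b) − |b − a|² is O(ε) together with its Lipschitz constant
(`NearlyFlat.exists_travelTimeSq`). The six squared edge lengths of a tetrahedron with one vertex at
0, as a function of the other three vertices, form a submersion at the regular tetrahedron. This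
survives a small Lipschitz perturbation, so some nondegenerate tetrahedron with vertex 0 has all six
values of Θ equal to any prescribed ℓ near 1 (`exists_regular_tetrahedron`).

Finally all four clocks get the same coordinate period T. The first one needs T√f(0) = pτ, and the
links need R√ℓ = N·T; both hold for ℓ = 1/f(0). Every signal is then delayed by exactly N readings,
and the claims on channels, phases and echoes follow formally. -/

set_option maxSynthPendingDepth 3

/-! ### Calculus of bounded Lipschitz maps -/

/-- `F` is bounded by `c` in norm and `c`-Lipschitz on `s`. -/
structure BoundedLipschitz {α G : Type*} [PseudoMetricSpace α] [SeminormedAddCommGroup G]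
    (s : Set α) (c : ℝ) (F : α → G) : Prop where
  bound : ∀ p ∈ s, ‖F p‖ ≤ c
  lip : ∀ p ∈ s, ∀ p' ∈ s, ‖F p - F p'‖ ≤ c * dist p p'

namespace BoundedLipschitz

variable {α G G' H : Type*} [PseudoMetricSpace α] [SeminormedAddCommGroup G]
  [SeminormedAddCommGroup G'] [SeminormedAddCommGroup H] {s : Set α} {a b c : ℝ}

theorem mono {F : α → G} (hF : BoundedLipschitz s a F) (hab : a ≤ b) : BoundedLipschitz s b F :=
  ⟨fun p hp => (hF.bound p hp).trans hab, fun p hp p' hp' =>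
    (hF.lip p hp p' hp').trans (by gcongr)⟩

theorem add {F F' : α → G} (hF : BoundedLipschitz s a F) (hF' : BoundedLipschitz s b F') :
    BoundedLipschitz s (a + b) (fun p => F p + F' p) := by
  refine ⟨fun p hp => (norm_add_le _ _).trans (add_le_add (hF.bound p hp) (hF'.bound p hp)),
    fun p hp p' hp' => ?_⟩
  rw [add_sub_add_comm, add_mul]
  exact (norm_add_le _ _).trans (add_le_add (hF.lip p hp p' hp') (hF'.lip p hp p' hp'))

theorem neg {F : α → G} (hF : BoundedLipschitz s a F) :
    BoundedLipschitz s a (fun p => -F p) := by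
  refine ⟨fun p hp => by simpa using hF.bound p hp, fun p hp p' hp' => ?_⟩
  rw [neg_sub_neg, norm_sub_rev]
  exact hF.lip p hp p' hp'

theorem sub {F F' : α → G} (hF : BoundedLipschitz s a F) (hF' : BoundedLipschitz s b F') :
    BoundedLipschitz s (a + b) (fun p => F p - F' p) := by
  simpa only [sub_eq_add_neg] using hF.add hF'.neg

theorem congr {F F' : α → G} (hF : BoundedLipschitz s a F) (h : ∀ p ∈ s, F' p = F p) :
    BoundedLipschitz s a F' :=
  ⟨fun p hp => by simpa only [h p hp] using hF.bound p hp,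
    fun p hp p' hp' => by simpa only [h p hp, h p' hp'] using hF.lip p hp p' hp'⟩

theorem const (x : G) (hc : ‖x‖ ≤ c) : BoundedLipschitz s c (fun _ => x) := by
  refine ⟨fun _ _ => hc, fun p _ p' _ => ?_⟩
  rw [sub_self, norm_zero]
  exact mul_nonneg ((norm_nonneg _).trans hc) dist_nonneg

/-- Telescoping B(x, y) − B(x', y') gives the Lipschitz constant 2ab, which also exceeds the sup
bound ab. One factor of order ε thus makes a product of order ε in both senses; the estimates for
the force and for the travel time rest on this. -/
theorem bilinear {F : α → G} {F' : α → G'} (B : G → G' → H)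
    (hB : ∀ x y, ‖B x y‖ ≤ ‖x‖ * ‖y‖) (hl : ∀ x x' y, B (x - x') y = B x y - B x' y)
    (hr : ∀ x y y', B x (y - y') = B x y - B x y')
    (hF : BoundedLipschitz s a F) (hF' : BoundedLipschitz s b F') (ha : 0 ≤ a) (hb : 0 ≤ b) :
    BoundedLipschitz s (2 * a * b) (fun p => B (F p) (F' p)) := by
  have hab := mul_nonneg ha hb
  refine ⟨fun p hp => ?_, fun p hp p' hp' => ?_⟩
  · calc ‖B (F p) (F' p)‖ ≤ ‖F p‖ * ‖F' p‖ := hB _ _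
      _ ≤ a * b := mul_le_mul (hF.bound p hp) (hF'.bound p hp) (norm_nonneg _) ha
      _ ≤ 2 * a * b := by linarith
  · have : B (F p) (F' p) - B (F p') (F' p')
        = B (F p - F p') (F' p) + B (F p') (F' p - F' p') := by rw [hl, hr]; abel
    rw [this]
    calc _ ≤ ‖F p - F p'‖ * ‖F' p‖ + ‖F p'‖ * ‖F' p - F' p'‖ :=
          (norm_add_le _ _).trans (add_le_add (hB _ _) (hB _ _))
      _ ≤ (a * dist p p') * b + a * (b * dist p p') :=
          add_le_add
            (mul_le_mul (hF.lip p hp p' hp') (hF'.bound p hp) (norm_nonneg _)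
              (mul_nonneg ha dist_nonneg))
            (mul_le_mul (hF.bound p' hp') (hF'.lip p hp p' hp') (norm_nonneg _) ha)
      _ = 2 * a * b * dist p p' := by ring

end BoundedLipschitz

namespace BoundedLipschitz

variable {α G H E : Type*} [PseudoMetricSpace α] [SeminormedAddCommGroup G] [NormedSpace ℝ G]
  [SeminormedAddCommGroup H] [NormedSpace ℝ H] [NormedAddCommGroup E] [InnerProductSpace ℝ E]
  {s : Set α} {a b : ℝ}

theorem smul {F : α → ℝ} {F' : α → H} (hF : BoundedLipschitz s a F)
    (hF' : BoundedLipschitz s b F') (ha : 0 ≤ a) (hb : 0 ≤ b) :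
    BoundedLipschitz s (2 * a * b) (fun p => F p • F' p) :=
  bilinear (fun x y => x • y) (fun x y => (norm_smul x y).le) (fun _ _ _ => sub_smul _ _ _)
    (fun _ _ _ => smul_sub _ _ _) hF hF' ha hb

theorem mul {F F' : α → ℝ} (hF : BoundedLipschitz s a F)
    (hF' : BoundedLipschitz s b F') (ha : 0 ≤ a) (hb : 0 ≤ b) :
    BoundedLipschitz s (2 * a * b) (fun p => F p * F' p) :=
  smul hF hF' ha hb

theorem clm_apply {F : α → G →L[ℝ] H} {F' : α → G} (hF : BoundedLipschitz s a F)
    (hF' : BoundedLipschitz s b F') (ha : 0 ≤ a) (hb : 0 ≤ b) :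
    BoundedLipschitz s (2 * a * b) (fun p => F p (F' p)) :=
  bilinear (fun x y => x y) (fun x y => x.le_opNorm y)
    (fun _ _ _ => sub_apply _ _ _)
    (fun _ _ _ => map_sub _ _ _) hF hF' ha hb

theorem inner {F F' : α → E} (hF : BoundedLipschitz s a F)
    (hF' : BoundedLipschitz s b F') (ha : 0 ≤ a) (hb : 0 ≤ b) :
    BoundedLipschitz s (2 * a * b) (fun p => Inner.inner ℝ (F p) (F' p)) :=
  bilinear (fun x y => Inner.inner ℝ x y) (fun x y => norm_inner_le_norm x y)
    (fun _ _ _ => inner_sub_left _ _ _)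
    (fun _ _ _ => inner_sub_right _ _ _) hF hF' ha hb

theorem flip {F : α → G →L[ℝ] G →L[ℝ] H} (hF : BoundedLipschitz s a F) :
    BoundedLipschitz s a (fun p => (F p).flip) := by
  refine ⟨fun p hp => by simpa using hF.bound p hp, fun p hp p' hp' => ?_⟩
  have : (F p).flip - (F p').flip = (F p - F p').flip := rfl
  rw [this, ContinuousLinearMap.opNorm_flip]
  exact hF.lip p hp p' hp'

end BoundedLipschitz

/-! ### Nearly flat static metrics and the force on rays -/

noncomputable section

variable {E : Type*} [NormedAddCommGroup E] [InnerProductSpace ℝ E]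

/-- The inner product as a bilinear form. -/
def innerForm (E : Type*) [NormedAddCommGroup E] [InnerProductSpace ℝ E] : E →L[ℝ] E →L[ℝ] ℝ :=
  innerSL ℝ

theorem innerForm_apply (u v : E) : innerForm E u v = inner ℝ u v := rfl

theorem norm_innerForm_le : ‖innerForm E‖ ≤ 1 := norm_innerSL_le ℝ

/-- The squared lapse `f` and the spatial metric `h` of a static metric `-f dt² + h` are
`C²`-close, with bound `ε`, to those of the Minkowski metric on the ball of radius `2`. -/
structure NearlyFlat (f : E → ℝ) (h : E → E →L[ℝ] E →L[ℝ] ℝ) (ε : ℝ) : Prop where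
  differentiable_lapse : ∀ x ∈ Metric.ball (0 : E) 2, DifferentiableAt ℝ f x
  differentiable_metric : ∀ x ∈ Metric.ball (0 : E) 2, DifferentiableAt ℝ h x
  symm : ∀ x ∈ Metric.ball (0 : E) 2, ∀ u v, h x u v = h x v u
  lapse : ∀ x ∈ Metric.ball (0 : E) 2, ‖f x - 1‖ ≤ ε
  metric : ∀ x ∈ Metric.ball (0 : E) 2, ‖h x - innerForm E‖ ≤ ε
  lapse_deriv : BoundedLipschitz (Metric.ball (0 : E) 2) ε (fderiv ℝ f)
  metric_deriv : BoundedLipschitz (Metric.ball (0 : E) 2) ε (fderiv ℝ h)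

namespace NearlyFlat

variable {f : E → ℝ} {h : E → E →L[ℝ] E →L[ℝ] ℝ} {ε : ℝ}

theorem boundedLipschitz_lapse (hfh : NearlyFlat f h ε) :
    BoundedLipschitz (Metric.ball (0 : E) 2) ε (fun x => f x - 1) := by
  refine ⟨hfh.lapse, fun p hp p' hp' => ?_⟩
  rw [sub_sub_sub_cancel_right, dist_eq_norm]
  exact (convex_ball (0 : E) 2).norm_image_sub_le_of_norm_hasFDerivWithin_le
    (fun x hx => (hfh.differentiable_lapse x hx).hasFDerivAt.hasFDerivWithinAt)
    (fun x hx => hfh.lapse_deriv.bound x hx) hp' hp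

theorem boundedLipschitz_metric (hfh : NearlyFlat f h ε) :
    BoundedLipschitz (Metric.ball (0 : E) 2) ε (fun x => h x - innerForm E) := by
  refine ⟨hfh.metric, fun p hp p' hp' => ?_⟩
  rw [sub_sub_sub_cancel_right, dist_eq_norm]
  exact (convex_ball (0 : E) 2).norm_image_sub_le_of_norm_hasFDerivWithin_le
    (fun x hx => (hfh.differentiable_metric x hx).hasFDerivAt.hasFDerivWithinAt)
    (fun x hx => hfh.metric_deriv.bound x hx) hp' hp

theorem boundedLipschitz_lapse_two (hfh : NearlyFlat f h ε) (hε : ε ≤ 1) :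
    BoundedLipschitz (Metric.ball (0 : E) 2) 2 f :=
  ((hfh.boundedLipschitz_lapse.add (.const 1 (by simp : ‖(1 : ℝ)‖ ≤ 1))).mono
    (by linarith)).congr (fun p _ => by ring)

theorem boundedLipschitz_metric_two (hfh : NearlyFlat f h ε) (hε : ε ≤ 1) :
    BoundedLipschitz (Metric.ball (0 : E) 2) 2 h :=
  ((hfh.boundedLipschitz_metric.add (.const (innerForm E) norm_innerForm_le)).mono
    (by linarith)).congr (fun p _ => by simp)

theorem eps_nonneg (hfh : NearlyFlat f h ε) : 0 ≤ ε :=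
  (norm_nonneg _).trans (hfh.lapse 0 (by simp))

theorem abs_lapse_sub_one_le (hfh : NearlyFlat f h ε) {x : E} (hx : x ∈ Metric.ball (0 : E) 2) :
    |f x - 1| ≤ ε := hfh.lapse x hx

theorem lapse_ge (hfh : NearlyFlat f h ε) (hε : ε ≤ 1 / 2) {x : E}
    (hx : x ∈ Metric.ball (0 : E) 2) : 1 / 2 ≤ f x := by
  have := abs_le.1 (hfh.abs_lapse_sub_one_le hx)
  linarith

theorem lapse_pos (hfh : NearlyFlat f h ε) (hε : ε ≤ 1 / 2) {x : E}
    (hx : x ∈ Metric.ball (0 : E) 2) : 0 < f x := by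
  linarith [hfh.lapse_ge hε hx]

theorem metric_pos (hfh : NearlyFlat f h ε) (hε : ε ≤ 1 / 2) {x : E}
    (hx : x ∈ Metric.ball (0 : E) 2) {v : E} (hv : v ≠ 0) : 0 < h x v v := by
  have h1 : ‖(h x - innerForm E) v v‖ ≤ ε * ‖v‖ * ‖v‖ :=
    ((h x - innerForm E).le_opNorm₂ v v).trans (by gcongr; exact hfh.metric x hx)
  have h2 : (h x - innerForm E) v v = h x v v - ‖v‖ * ‖v‖ := by
    simp [innerForm_apply, sq]
  rw [h2, Real.norm_eq_abs] at h1
  have h3 := (abs_le.1 h1).1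
  have h4 : 0 < ‖v‖ * ‖v‖ := by positivity
  nlinarith

end NearlyFlat

/-- The covector `Λ` for which `⟨q, ·⟩ + Λ = 0` is the equation of the space part (position `x`,
velocity `v`, acceleration `q`) of affinely parametrized null geodesics of `-f dt² + h`. -/
def forceForm (f : E → ℝ) (h : E → E →L[ℝ] E →L[ℝ] ℝ) (x v q : E) : E →L[ℝ] ℝ :=
  (f x - 1) • h x q + (h x - innerForm E) q + f x • fderiv ℝ h x v v
    - (1 / 2 : ℝ) • f x • (((fderiv ℝ h x).flip v).flip v)
    + (1 / 2 : ℝ) • h x v v • fderiv ℝ f x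

/-- Up to powers of R, the right side is f times the space part of the geodesic equation, where the
null condition f·t'² = R²·h(v, v) has replaced t'². No trace of the time coordinate remains, and
splitting off ⟨q, ·⟩ leaves only small terms in Λ. -/
theorem inner_add_forceForm (f : E → ℝ) (h : E → E →L[ℝ] E →L[ℝ] ℝ) (x v q w : E) :
    inner ℝ q w + forceForm f h x v q w =
      f x * h x q w + f x * fderiv ℝ h x v v w - 1 / 2 * (f x * fderiv ℝ h x w v v)
        + 1 / 2 * (h x v v * fderiv ℝ f x w) := by
  simp only [forceForm, add_apply, sub_apply,
    smul_apply, ContinuousLinearMap.flip_apply, smul_eq_mul, innerForm_apply]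
  ring

variable {f : E → ℝ} {h : E → E →L[ℝ] E →L[ℝ] ℝ} {ε : ℝ}

theorem boundedLipschitz_comp_fst {α β G : Type*} [PseudoMetricSpace α] [PseudoMetricSpace β]
    [SeminormedAddCommGroup G] {s : Set α} {t : Set β} {c : ℝ} {F : α → G}
    (hc : 0 ≤ c) (hF : BoundedLipschitz s c F) :
    BoundedLipschitz (s ×ˢ t) c (fun p => F p.1) :=
  ⟨fun _ hp => hF.bound _ hp.1, fun _ hp _ hp' => (hF.lip _ hp.1 _ hp'.1).trans
    (mul_le_mul_of_nonneg_left (le_max_left _ _) hc)⟩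

theorem boundedLipschitz_comp_snd {α β G : Type*} [PseudoMetricSpace α] [PseudoMetricSpace β]
    [SeminormedAddCommGroup G] {s : Set α} {t : Set β} {c : ℝ} {F : β → G}
    (hc : 0 ≤ c) (hF : BoundedLipschitz t c F) :
    BoundedLipschitz (s ×ˢ t) c (fun p => F p.2) :=
  ⟨fun _ hp => hF.bound _ hp.2, fun _ hp _ hp' => (hF.lip _ hp.2 _ hp'.2).trans
    (mul_le_mul_of_nonneg_left (le_max_right _ _) hc)⟩

theorem boundedLipschitz_id {G : Type*} [SeminormedAddCommGroup G] {c : ℝ} (hc : 1 ≤ c) :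
    BoundedLipschitz (Metric.closedBall (0 : G) c) c (fun x => x) :=
  ⟨fun p hp => by simpa using hp, fun p _ p' _ => by
    rw [← dist_eq_norm]; exact le_mul_of_one_le_left dist_nonneg hc⟩

/-- Admissible positions, velocities and accelerations. -/
def jetDomain (E : Type*) [NormedAddCommGroup E] : Set (E × E × E) :=
  Metric.ball 0 2 ×ˢ Metric.closedBall 0 20 ×ˢ Metric.closedBall 0 20

/-- Every summand has exactly one factor of order ε, namely f − 1, h − ⟨·, ·⟩, dh or df; the other
factors are bounded by 2, 20 or 1/2. The product rule gives 19400ε in total. -/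
theorem NearlyFlat.boundedLipschitz_forceForm (hfh : NearlyFlat f h ε) (hε : ε ≤ 1) :
    BoundedLipschitz (jetDomain E) (20000 * ε) (fun p => forceForm f h p.1 p.2.1 p.2.2) := by
  have h0 := hfh.eps_nonneg
  have hf1 : BoundedLipschitz (jetDomain E) ε (fun p => f p.1 - 1) :=
    boundedLipschitz_comp_fst h0 hfh.boundedLipschitz_lapse
  have hh1 : BoundedLipschitz (jetDomain E) ε (fun p => h p.1 - innerForm E) :=
    boundedLipschitz_comp_fst h0 hfh.boundedLipschitz_metric
  have hf2 : BoundedLipschitz (jetDomain E) 2 (fun p => f p.1) :=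
    boundedLipschitz_comp_fst (by norm_num) (hfh.boundedLipschitz_lapse_two hε)
  have hh2 : BoundedLipschitz (jetDomain E) 2 (fun p => h p.1) :=
    boundedLipschitz_comp_fst (by norm_num) (hfh.boundedLipschitz_metric_two hε)
  have hf' : BoundedLipschitz (jetDomain E) ε (fun p => fderiv ℝ f p.1) :=
    boundedLipschitz_comp_fst h0 hfh.lapse_deriv
  have hh' : BoundedLipschitz (jetDomain E) ε (fun p => fderiv ℝ h p.1) :=
    boundedLipschitz_comp_fst h0 hfh.metric_deriv
  have hv : BoundedLipschitz (jetDomain E) 20 (fun p => p.2.1) :=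
    boundedLipschitz_comp_snd (by norm_num)
      (boundedLipschitz_comp_fst (by norm_num) (boundedLipschitz_id (by norm_num)))
  have hq : BoundedLipschitz (jetDomain E) 20 (fun p => p.2.2) :=
    boundedLipschitz_comp_snd (by norm_num)
      (boundedLipschitz_comp_snd (by norm_num) (boundedLipschitz_id (by norm_num)))
  have half : BoundedLipschitz (jetDomain E) (1 / 2) (fun _ => (1 / 2 : ℝ)) :=
    .const _ (by norm_num)
  have t1 := hf1.smul (hh2.clm_apply hq (by positivity) (by positivity))
    (by positivity) (by positivity)
  have t2 := hh1.clm_apply hq (by positivity) (by positivity)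
  have t3 := hf2.smul ((hh'.clm_apply hv (by positivity) (by positivity)).clm_apply hv
    (by positivity) (by positivity)) (by positivity) (by positivity)
  have t4 := half.smul (hf2.smul (((hh'.flip).clm_apply hv (by positivity)
    (by positivity)).flip.clm_apply hv
    (by positivity) (by positivity)) (by positivity) (by positivity)) (by positivity)
    (by positivity)
  have t5 := half.smul (((hh2.clm_apply hv (by positivity) (by positivity)).clm_apply hv
    (by positivity) (by positivity)).smul hf' (by positivity) (by positivity)) (by positivity)
    (by positivity)
  exact ((((t1.add t2).add t3).sub t4).add t5).mono (by linarith)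

/-- Needed before any bound on the velocity is known, so only x is restricted and the dependence on
q and v stays explicit. -/
theorem NearlyFlat.norm_forceForm_le (hfh : NearlyFlat f h ε) (hε : ε ≤ 1) {x : E}
    (hx : x ∈ Metric.ball (0 : E) 2) (v q : E) :
    ‖forceForm f h x v q‖ ≤ 4 * ε * (‖q‖ + ‖v‖ ^ 2) := by
  have h0 := hfh.eps_nonneg
  have hf1 := hfh.lapse x hx
  have hh1 := hfh.metric x hx
  have hf2 := (hfh.boundedLipschitz_lapse_two hε).bound x hx
  have hh2 := (hfh.boundedLipschitz_metric_two hε).bound x hx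
  have hf' := hfh.lapse_deriv.bound x hx
  have hh' := hfh.metric_deriv.bound x hx
  have t1 : ‖(f x - 1) • h x q‖ ≤ ε * (2 * ‖q‖) := by
    rw [norm_smul]
    exact mul_le_mul hf1 ((h x).le_of_opNorm_le hh2 q) (norm_nonneg _) h0
  have t2 : ‖(h x - innerForm E) q‖ ≤ ε * ‖q‖ := ContinuousLinearMap.le_of_opNorm_le _ hh1 q
  have t3 : ‖f x • fderiv ℝ h x v v‖ ≤ 2 * (ε * ‖v‖ * ‖v‖) := by
    rw [norm_smul]
    exact mul_le_mul hf2 (((fderiv ℝ h x).le_opNorm₂ v v).trans (by gcongr)) (norm_nonneg _)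
      (by norm_num)
  have t4 : ‖(1 / 2 : ℝ) • f x • (((fderiv ℝ h x).flip v).flip v)‖
      ≤ 1 / 2 * (2 * (ε * ‖v‖ * ‖v‖)) := by
    rw [norm_smul, norm_smul]
    refine mul_le_mul (by norm_num) (mul_le_mul hf2 ?_ (norm_nonneg _) (by norm_num))
      (by positivity) (by norm_num)
    refine (ContinuousLinearMap.le_opNorm _ _).trans ?_
    rw [ContinuousLinearMap.opNorm_flip]
    gcongr
    refine (ContinuousLinearMap.le_opNorm _ _).trans ?_
    rw [ContinuousLinearMap.opNorm_flip]
    gcongr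
  have t5 : ‖(1 / 2 : ℝ) • h x v v • fderiv ℝ f x‖ ≤ 1 / 2 * ((2 * ‖v‖ * ‖v‖) * ε) := by
    rw [norm_smul, norm_smul]
    exact mul_le_mul (by norm_num) (mul_le_mul (((h x).le_opNorm₂ v v).trans (by gcongr)) hf'
      (norm_nonneg _) (by positivity)) (by positivity) (by norm_num)
  have key : ‖forceForm f h x v q‖ ≤ ε * (2 * ‖q‖) + ε * ‖q‖ + 2 * (ε * ‖v‖ * ‖v‖)
      + 1 / 2 * (2 * (ε * ‖v‖ * ‖v‖)) + 1 / 2 * ((2 * ‖v‖ * ‖v‖) * ε) :=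
    (norm_add_le _ _).trans (add_le_add ((norm_sub_le _ _).trans (add_le_add
      ((norm_add_le _ _).trans (add_le_add ((norm_add_le _ _).trans (add_le_add t1 t2)) t3)) t4))
      t5)
  have : 0 ≤ ε * ‖q‖ := by positivity
  nlinarith
end

/-! ### Rays: a priori bounds and uniqueness -/

noncomputable section

variable {E : Type*} [NormedAddCommGroup E] [InnerProductSpace ℝ E]

/-- `y` is a twice continuously differentiable path on `[0, 1]` with velocity `v` and
acceleration `q`. -/
structure IsC2Path (y v q : ℝ → E) : Prop where
  velocity : ∀ s ∈ Icc (0 : ℝ) 1, HasDerivWithinAt y (v s) (Icc 0 1) s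
  acceleration : ∀ s ∈ Icc (0 : ℝ) 1, HasDerivWithinAt v (q s) (Icc 0 1) s
  continuousOn : ContinuousOn q (Icc 0 1)

theorem HasDerivWithinAt.sub_smul {y : ℝ → E} {y' : E} {t : Set ℝ} {s : ℝ}
    (hy : HasDerivWithinAt y y' t s) (u : E) :
    HasDerivWithinAt (fun s => y s - s • u) (y' - u) t s := by
  have := hy.sub ((hasDerivWithinAt_id s t).smul_const u)
  rw [one_smul] at this
  exact this

namespace IsC2Path

variable {y v q y' v' q' : ℝ → E} {K : ℝ}

theorem sub (hy : IsC2Path y v q) (hy' : IsC2Path y' v' q') :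
    IsC2Path (fun s => y s - y' s) (fun s => v s - v' s) (fun s => q s - q' s) :=
  ⟨fun s hs => (hy.velocity s hs).sub (hy'.velocity s hs),
    fun s hs => (hy.acceleration s hs).sub (hy'.acceleration s hs),
    hy.continuousOn.sub hy'.continuousOn⟩

theorem continuousOn_velocity (hy : IsC2Path y v q) : ContinuousOn v (Icc 0 1) :=
  fun s hs => (hy.acceleration s hs).continuousWithinAt

theorem continuousOn_position (hy : IsC2Path y v q) : ContinuousOn y (Icc 0 1) :=
  fun s hs => (hy.velocity s hs).continuousWithinAt

theorem norm_position_sub_le (hy : IsC2Path y v q) (hv : ∀ s ∈ Icc (0 : ℝ) 1, ‖v s‖ ≤ K)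
    {s : ℝ} (hs : s ∈ Icc (0 : ℝ) 1) : ‖y s - y 0‖ ≤ K := by
  have h := (convex_Icc (0 : ℝ) 1).norm_image_sub_le_of_norm_hasDerivWithin_le hy.velocity hv
    (left_mem_Icc.2 zero_le_one) hs
  have hK : 0 ≤ K := (norm_nonneg _).trans (hv s hs)
  refine h.trans (mul_le_of_le_one_right hK ?_)
  rw [sub_zero, Real.norm_of_nonneg hs.1]
  exact hs.2

theorem norm_velocity_sub_le (hy : IsC2Path y v q) (hq : ∀ s ∈ Icc (0 : ℝ) 1, ‖q s‖ ≤ K)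
    {s s' : ℝ} (hs : s ∈ Icc (0 : ℝ) 1) (hs' : s' ∈ Icc (0 : ℝ) 1) :
    ‖v s' - v s‖ ≤ K * |s' - s| :=
  (convex_Icc (0 : ℝ) 1).norm_image_sub_le_of_norm_hasDerivWithin_le hy.acceleration hq hs hs'

/-- Subtracting the linear motion with velocity v(s) leaves a path of speed at most K, whose total
displacement is the chord minus v(s). -/
theorem norm_velocity_sub_chord_le (hy : IsC2Path y v q)
    (hq : ∀ s ∈ Icc (0 : ℝ) 1, ‖q s‖ ≤ K) {s : ℝ} (hs : s ∈ Icc (0 : ℝ) 1) :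
    ‖v s - (y 1 - y 0)‖ ≤ K := by
  have hK : 0 ≤ K := (norm_nonneg _).trans (hq s hs)
  have hd : ∀ σ ∈ Icc (0 : ℝ) 1,
      HasDerivWithinAt (fun σ => y σ - σ • v s) (v σ - v s) (Icc 0 1) σ :=
    fun σ hσ => (hy.velocity σ hσ).sub_smul (v s)
  have hb : ∀ σ ∈ Icc (0 : ℝ) 1, ‖v σ - v s‖ ≤ K := fun σ hσ => by
    refine (hy.norm_velocity_sub_le hq hs hσ).trans (mul_le_of_le_one_right hK ?_)
    rw [abs_le]
    constructor <;> linarith [hs.1, hs.2, hσ.1, hσ.2]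
  have h := (convex_Icc (0 : ℝ) 1).norm_image_sub_le_of_norm_hasDerivWithin_le hd hb
    (left_mem_Icc.2 zero_le_one) (right_mem_Icc.2 zero_le_one)
  rw [norm_sub_rev]
  simpa [sub_right_comm] using h

/-- A path with small acceleration stays close to the affine path between its endpoints. -/
theorem norm_position_sub_chord_le (hy : IsC2Path y v q)
    (hq : ∀ s ∈ Icc (0 : ℝ) 1, ‖q s‖ ≤ K) {s : ℝ} (hs : s ∈ Icc (0 : ℝ) 1) :
    ‖y s - (y 0 + s • (y 1 - y 0))‖ ≤ K := by
  have hK : 0 ≤ K := (norm_nonneg _).trans (hq s hs)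
  have hd : ∀ σ ∈ Icc (0 : ℝ) 1,
      HasDerivWithinAt (fun σ => y σ - σ • (y 1 - y 0)) (v σ - (y 1 - y 0)) (Icc 0 1) σ :=
    fun σ hσ => (hy.velocity σ hσ).sub_smul (y 1 - y 0)
  have h := (convex_Icc (0 : ℝ) 1).norm_image_sub_le_of_norm_hasDerivWithin_le hd
    (fun σ hσ => hy.norm_velocity_sub_chord_le hq hσ) (left_mem_Icc.2 zero_le_one) hs
  have h2 : y s - (y 0 + s • (y 1 - y 0)) = y s - s • (y 1 - y 0) - (y 0 - (0 : ℝ) • (y 1 - y 0)) := by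
    rw [zero_smul]; abel
  rw [h2]
  refine h.trans (mul_le_of_le_one_right hK ?_)
  rw [sub_zero, Real.norm_of_nonneg hs.1]
  exact hs.2

end IsC2Path

/-- `y`, with velocity `v` and acceleration `q`, is the space part of an affinely parametrized
null geodesic of `-f dt² + h` in the ball of radius `2`. -/
structure IsRay (f : E → ℝ) (h : E → E →L[ℝ] E →L[ℝ] ℝ) (y v q : ℝ → E) : Prop
    extends IsC2Path y v q where
  mem : ∀ s ∈ Icc (0 : ℝ) 1, y s ∈ Metric.ball (0 : E) 2
  equation : ∀ s ∈ Icc (0 : ℝ) 1, ∀ w,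
    inner ℝ (q s) w + forceForm f h (y s) (v s) (q s) w = 0

theorem norm_le_of_inner_add_eq_zero {u : E} {L : E →L[ℝ] ℝ} (h : ∀ w, inner ℝ u w + L w = 0) :
    ‖u‖ ≤ ‖L‖ := by
  by_contra! hlt
  have h1 := h u
  rw [real_inner_self_eq_norm_mul_norm] at h1
  have h2 := abs_le.1 (L.le_opNorm u)
  have h3 : 0 < ‖u‖ := (norm_nonneg _).trans_lt hlt
  nlinarith [h2.1]

variable {f : E → ℝ} {h : E → E →L[ℝ] E →L[ℝ] ℝ} {ε : ℝ}

namespace IsRay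

variable {y v q y' v' q' : ℝ → E}

/-- The force bound contains 4ε‖q‖, which for such ε is absorbed into the left side. -/
theorem norm_acceleration_le (hfh : NearlyFlat f h ε) (hε : ε ≤ 1 / 1000000)
    (hy : IsRay f h y v q) {s : ℝ} (hs : s ∈ Icc (0 : ℝ) 1) :
    ‖q s‖ ≤ 8 * ε * ‖v s‖ ^ 2 := by
  have h0 := hfh.eps_nonneg
  have h1 := (norm_le_of_inner_add_eq_zero (hy.equation s hs)).trans
    (hfh.norm_forceForm_le (by linarith) (hy.mem s hs) (v s) (q s))
  have h2 : 4 * ε * ‖q s‖ ≤ 1 / 2 * ‖q s‖ := by gcongr; linarith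
  linarith

/-- A ray that is too fast would leave the ball before its direction can change. -/
theorem norm_velocity_le (hfh : NearlyFlat f h ε) (hε : ε ≤ 1 / 1000000)
    (hy : IsRay f h y v q) {s : ℝ} (hs : s ∈ Icc (0 : ℝ) 1) : ‖v s‖ ≤ 20 := by
  have h0 := hfh.eps_nonneg
  obtain ⟨s₀, hs₀, hmax⟩ := isCompact_Icc.exists_isMaxOn ⟨s, hs⟩ hy.continuousOn_velocity.norm
  refine (hmax hs).trans ?_
  set M := ‖v s₀‖ with hM
  have hmax' : ∀ σ ∈ Icc (0 : ℝ) 1, ‖v σ‖ ≤ M := fun σ hσ => hmax hσ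
  change M ≤ 20
  by_contra! hlt
  have hq : ∀ σ ∈ Icc (0 : ℝ) 1, ‖q σ‖ ≤ 8 * ε * M ^ 2 := fun σ hσ => by
    refine (hy.norm_acceleration_le hfh hε hσ).trans ?_
    gcongr
    exact hmax' σ hσ
  -- During a parameter span 10/M the ray would move a distance 10 up to an error 800ε, while the
  -- ball has diameter 4. As 10/M < 1/2, the span fits into [0, 1] on one side of s₀.
  have hτ0 : 0 < 10 / M := by positivity
  have hτ : 10 / M < 1 / 2 := by rw [div_lt_iff₀ (by linarith)]; linarith
  obtain ⟨s₁, hs₁, hdist⟩ : ∃ s₁ ∈ Icc (0 : ℝ) 1, |s₁ - s₀| = 10 / M := by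
    rcases le_total s₀ (1 / 2) with hle | hle
    · exact ⟨s₀ + 10 / M, ⟨by linarith [hs₀.1], by linarith⟩, by simp [abs_of_pos hτ0]⟩
    · exact ⟨s₀ - 10 / M, ⟨by linarith, by linarith [hs₀.2]⟩, by simp [abs_of_pos hτ0]⟩
  have hsub : uIcc s₀ s₁ ⊆ Icc 0 1 := uIcc_subset_Icc hs₀ hs₁
  have hd : ∀ σ ∈ uIcc s₀ s₁,
      HasDerivWithinAt (fun σ => y σ - σ • v s₀) (v σ - v s₀) (uIcc s₀ s₁) σ :=
    fun σ hσ => ((hy.velocity σ (hsub hσ)).mono hsub).sub_smul (v s₀)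
  have hb : ∀ σ ∈ uIcc s₀ s₁, ‖v σ - v s₀‖ ≤ 8 * ε * M ^ 2 * (10 / M) := fun σ hσ => by
    refine (hy.norm_velocity_sub_le hq hs₀ (hsub hσ)).trans ?_
    rw [← hdist]
    gcongr 8 * ε * M ^ 2 * ?_
    exact abs_sub_left_of_mem_uIcc hσ
  have hmv := (convex_uIcc s₀ s₁).norm_image_sub_le_of_norm_hasDerivWithin_le hd hb
    left_mem_uIcc right_mem_uIcc
  rw [Real.norm_eq_abs, hdist] at hmv
  have e1 : 8 * ε * M ^ 2 * (10 / M) * (10 / M) = 800 * ε := by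
    have : M ≠ 0 := by linarith
    field_simp
    ring
  rw [e1] at hmv
  have e2 : (s₁ - s₀) • v s₀ = (y s₁ - y s₀) - (y s₁ - s₁ • v s₀ - (y s₀ - s₀ • v s₀)) := by
    rw [sub_smul]; abel
  have e3 : ‖(s₁ - s₀) • v s₀‖ = 10 := by
    have : M ≠ 0 := by linarith
    rw [norm_smul, Real.norm_eq_abs, hdist, ← hM]
    field_simp
  have e4 := norm_sub_le (y s₁ - y s₀) (y s₁ - s₁ • v s₀ - (y s₀ - s₀ • v s₀))
  rw [← e2, e3] at e4
  have e5 := norm_sub_le (y s₁) (y s₀)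
  have e6 := mem_ball_zero_iff.1 (hy.mem s₀ hs₀)
  have e7 := mem_ball_zero_iff.1 (hy.mem s₁ hs₁)
  linarith

theorem norm_acceleration_le' (hfh : NearlyFlat f h ε) (hε : ε ≤ 1 / 1000000)
    (hy : IsRay f h y v q) {s : ℝ} (hs : s ∈ Icc (0 : ℝ) 1) : ‖q s‖ ≤ 3200 * ε := by
  have h0 := hfh.eps_nonneg
  have h1 := hy.norm_velocity_le hfh hε hs
  calc ‖q s‖ ≤ 8 * ε * ‖v s‖ ^ 2 := hy.norm_acceleration_le hfh hε hs
    _ ≤ 8 * ε * 20 ^ 2 := by gcongr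
    _ = 3200 * ε := by ring

theorem mem_jetDomain (hfh : NearlyFlat f h ε) (hε : ε ≤ 1 / 1000000)
    (hy : IsRay f h y v q) {s : ℝ} (hs : s ∈ Icc (0 : ℝ) 1) :
    (y s, v s, q s) ∈ jetDomain E := by
  refine ⟨hy.mem s hs, ?_, ?_⟩
  · simpa using hy.norm_velocity_le hfh hε hs
  · have := hy.norm_acceleration_le' hfh hε hs
    simp only [mem_closedBall_zero_iff]
    linarith

theorem norm_acceleration_sub_le_of_forall (hfh : NearlyFlat f h ε) (hε : ε ≤ 1 / 1000000)
    (hy : IsRay f h y v q) (hy' : IsRay f h y' v' q') {s : ℝ} (hs : s ∈ Icc (0 : ℝ) 1) :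
    ‖q s - q' s‖ ≤ 20000 * ε * dist (y s, v s, q s) (y' s, v' s, q' s) := by
  refine (norm_le_of_inner_add_eq_zero (L := forceForm f h (y s) (v s) (q s)
    - forceForm f h (y' s) (v' s) (q' s)) fun w => ?_).trans
    ((hfh.boundedLipschitz_forceForm (by linarith)).lip (y s, v s, q s)
      (hy.mem_jetDomain hfh hε hs) (y' s, v' s, q' s) (hy'.mem_jetDomain hfh hε hs))
  have h1 := hy.equation s hs w
  have h2 := hy'.equation s hs w
  rw [inner_sub_left, sub_apply]
  linarith

end IsRay

/-- The difference of the paths is a path too: its velocity is close to its chord, and its position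
follows by integration. Thus endpoints and accelerations control the whole jet. -/
theorem IsC2Path.dist_le {y v q y' v' q' : ℝ → E} {K : ℝ} (hy : IsC2Path y v q)
    (hy' : IsC2Path y' v' q') (hq : ∀ s ∈ Icc (0 : ℝ) 1, ‖q s - q' s‖ ≤ K)
    {s : ℝ} (hs : s ∈ Icc (0 : ℝ) 1) :
    dist (y s, v s, q s) (y' s, v' s, q' s) ≤ 2 * (‖y 0 - y' 0‖ + ‖y 1 - y' 1‖) + K := by
  have hd := hy.sub hy'
  have hv : ∀ s ∈ Icc (0 : ℝ) 1, ‖v s - v' s‖ ≤ ‖y 0 - y' 0‖ + ‖y 1 - y' 1‖ + K :=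
    fun s hs => by
      have h1 := hd.norm_velocity_sub_chord_le hq hs
      have h2 := norm_sub_le (y 1 - y' 1) (y 0 - y' 0)
      have h3 := norm_sub_norm_le (v s - v' s) (y 1 - y' 1 - (y 0 - y' 0))
      linarith
  have hp := hd.norm_position_sub_le hv hs
  have hp' := norm_sub_norm_le (y s - y' s) (y 0 - y' 0)
  have h0 := norm_nonneg (y 0 - y' 0)
  have h1 := norm_nonneg (y 1 - y' 1)
  rw [Prod.dist_eq, Prod.dist_eq]
  simp only [dist_eq_norm]
  refine max_le (by linarith) (max_le ?_ ?_)
  · linarith [hv s hs]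
  · linarith [hq s hs]

/-- Rays depend Lipschitz continuously on their endpoints. -/
theorem IsRay.norm_acceleration_sub_le {y v q y' v' q' : ℝ → E} (hfh : NearlyFlat f h ε)
    (hε : ε ≤ 1 / 1000000) (hy : IsRay f h y v q) (hy' : IsRay f h y' v' q') {s : ℝ}
    (hs : s ∈ Icc (0 : ℝ) 1) :
    ‖q s - q' s‖ ≤ 80000 * ε * (‖y 0 - y' 0‖ + ‖y 1 - y' 1‖) := by
  have h0 := hfh.eps_nonneg
  obtain ⟨s₀, hs₀, hmax⟩ := isCompact_Icc.exists_isMaxOn ⟨s, hs⟩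
    (hy.continuousOn.sub hy'.continuousOn).norm
  have hmax' : ∀ σ ∈ Icc (0 : ℝ) 1, ‖q σ - q' σ‖ ≤ ‖q s₀ - q' s₀‖ := fun σ hσ => hmax hσ
  refine (hmax' s hs).trans ?_
  have h1 := hy.norm_acceleration_sub_le_of_forall hfh hε hy' hs₀
  have h2 := hy.toIsC2Path.dist_le hy'.toIsC2Path hmax' hs₀
  set K := ‖q s₀ - q' s₀‖
  set D := ‖y 0 - y' 0‖ + ‖y 1 - y' 1‖
  -- The largest difference K of the accelerations is bounded by itself with a factor below 1/2,
  -- which is absorbed.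
  have h3 : K ≤ 20000 * ε * (2 * D + K) := h1.trans (by gcongr)
  have h4 : 20000 * ε * K ≤ 1 / 2 * K := by gcongr; linarith
  linarith

/-- Rays with the same endpoints agree. -/
theorem IsRay.eqOn {y v q y' v' q' : ℝ → E} (hfh : NearlyFlat f h ε)
    (hε : ε ≤ 1 / 1000000) (hy : IsRay f h y v q) (hy' : IsRay f h y' v' q')
    (h0 : y 0 = y' 0) (h1 : y 1 = y' 1) {s : ℝ} (hs : s ∈ Icc (0 : ℝ) 1) :
    y s = y' s ∧ v s = v' s := by
  have hq : ∀ s ∈ Icc (0 : ℝ) 1, ‖q s - q' s‖ ≤ 0 := fun s hs => by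
    simpa [h0, h1] using hy.norm_acceleration_sub_le hfh hε hy' hs
  have h2 := hy.toIsC2Path.dist_le hy'.toIsC2Path hq hs
  simp only [h0, h1, sub_self, norm_zero, add_zero, mul_zero] at h2
  have h3 := dist_le_zero.1 h2
  simp only [Prod.mk.injEq] at h3
  exact ⟨h3.1, h3.2.1⟩

/-! ### Existence of rays with given endpoints -/

/-- The velocity of the path from `a` to `b` with acceleration `q`. -/
def pathVelocity (a b : E) (q : ℝ → E) (s : ℝ) : E :=
  (b - a) + (∫ σ in (0 : ℝ)..s, q σ) - ∫ τ in (0 : ℝ)..1, ∫ σ in (0 : ℝ)..τ, q σ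

/-- The path from `a` to `b` with acceleration `q`. -/
def pathPosition (a b : E) (q : ℝ → E) (s : ℝ) : E :=
  a + ∫ σ in (0 : ℝ)..s, pathVelocity a b q σ

theorem pathPosition_zero (a b : E) (q : ℝ → E) : pathPosition a b q 0 = a := by
  simp [pathPosition]

section Path

variable [CompleteSpace E] (a b : E) {q : ℝ → E}

theorem hasDerivAt_primitive (hq : Continuous q) (s : ℝ) :
    HasDerivAt (fun s => ∫ σ in (0 : ℝ)..s, q σ) (q s) s :=
  (hq.integral_hasStrictDerivAt 0 s).hasDerivAt

theorem hasDerivAt_pathVelocity (hq : Continuous q) (s : ℝ) :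
    HasDerivAt (pathVelocity a b q) (q s) s :=
  ((hasDerivAt_primitive hq s).const_add (b - a)).sub_const _

theorem continuous_pathVelocity (hq : Continuous q) : Continuous (pathVelocity a b q) :=
  continuous_iff_continuousAt.2 fun s => (hasDerivAt_pathVelocity a b hq s).continuousAt

theorem hasDerivAt_pathPosition (hq : Continuous q) (s : ℝ) :
    HasDerivAt (pathPosition a b q) (pathVelocity a b q s) s :=
  (hasDerivAt_primitive (continuous_pathVelocity a b hq) s).const_add a

theorem isC2Path_pathPosition (hq : Continuous q) :
    IsC2Path (pathPosition a b q) (pathVelocity a b q) q :=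
  ⟨fun s _ => (hasDerivAt_pathPosition a b hq s).hasDerivWithinAt,
    fun s _ => (hasDerivAt_pathVelocity a b hq s).hasDerivWithinAt, hq.continuousOn⟩

/-- The double integral in `pathVelocity` is the mean over [0, 1] of the primitive of q; subtracting
it gives the velocity the mean b − a. -/
theorem pathPosition_one (hq : Continuous q) : pathPosition a b q 1 = b := by
  have hJ : Continuous fun s => ∫ σ in (0 : ℝ)..s, q σ :=
    continuous_iff_continuousAt.2 fun s => (hasDerivAt_primitive hq s).continuousAt
  have h1 : ∫ σ in (0 : ℝ)..1, pathVelocity a b q σ = b - a := by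
    have h2 : IntervalIntegrable (fun s => (b - a) + ∫ σ in (0 : ℝ)..s, q σ)
        MeasureTheory.volume 0 1 := (continuous_const.add hJ).intervalIntegrable _ _
    simp only [pathVelocity]
    rw [intervalIntegral.integral_sub h2 intervalIntegrable_const,
      intervalIntegral.integral_add intervalIntegrable_const (hJ.intervalIntegrable _ _)]
    simp
  rw [pathPosition, h1]
  abel

end Path

/-- The continuous extension to the line of a function on `[0, 1]`. -/
def extendIcc {G : Type*} [NormedAddCommGroup G] (q : C(Icc (0 : ℝ) 1, G)) : ℝ → G := IccExtend zero_le_one q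

theorem continuous_extendIcc {G : Type*} [NormedAddCommGroup G] (q : C(Icc (0 : ℝ) 1, G)) : Continuous (extendIcc q) :=
  q.continuous.Icc_extend'

theorem extendIcc_apply {G : Type*} [NormedAddCommGroup G] (q : C(Icc (0 : ℝ) 1, G))
    {s : ℝ} (hs : s ∈ Icc (0 : ℝ) 1) :
    extendIcc q s = q ⟨s, hs⟩ :=
  IccExtend_of_mem zero_le_one q hs

theorem norm_extendIcc_le {G : Type*} [NormedAddCommGroup G] {q : C(Icc (0 : ℝ) 1, G)}
    (hq : ‖q‖ ≤ 1 / 10) {s : ℝ}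
    (hs : s ∈ Icc (0 : ℝ) 1) : ‖extendIcc q s‖ ≤ 1 / 10 := by
  rw [extendIcc_apply q hs]
  exact (q.norm_coe_le_norm _).trans hq

/-- The segment between the endpoints lies in the convex ball of radius 6/5 and the path within 1/10
of it, hence in the ball of radius 2. The chord is shorter than 12/5, so the speed is at most 12/5 +
1/10 = 5/2. -/
theorem mem_jetDomain_of_isC2Path {y v q : ℝ → E} (ha : ‖y 0‖ < 6 / 5) (hb : ‖y 1‖ < 6 / 5)
    (hy : IsC2Path y v q) (hq : ∀ s ∈ Icc (0 : ℝ) 1, ‖q s‖ ≤ 1 / 10) {s : ℝ}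
    (hs : s ∈ Icc (0 : ℝ) 1) : (y s, v s, q s) ∈ jetDomain E ∧ ‖v s‖ ≤ 5 / 2 := by
  have h1 := hy.norm_velocity_sub_chord_le hq hs
  have h2 := hy.norm_position_sub_chord_le hq hs
  have h3 := norm_sub_norm_le (v s) (y 1 - y 0)
  have h4 := norm_sub_norm_le (y s) (y 0 + s • (y 1 - y 0))
  have h5 := norm_sub_le (y 1) (y 0)
  have h6 : ‖y 0 + s • (y 1 - y 0)‖ < 6 / 5 := by
    have := (convex_ball (0 : E) (6 / 5)).add_smul_sub_mem (x := y 0) (y := y 1)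
      (by simpa using ha) (by simpa using hb) hs
    simpa using this
  refine ⟨⟨?_, ?_, ?_⟩, by linarith⟩
  · rw [mem_ball_zero_iff]; dsimp only; linarith
  · rw [mem_closedBall_zero_iff]; dsimp only; linarith
  · rw [mem_closedBall_zero_iff]; dsimp only; linarith [hq s hs]

section Existence

variable [CompleteSpace E] {a b : E}

/-- Position, velocity and acceleration at `s` of the path from `a` to `b` with
acceleration `q`. -/
def jetOf (a b : E) (q : C(Icc (0 : ℝ) 1, E)) (s : ℝ) : E × E × E :=
  (pathPosition a b (extendIcc q) s, pathVelocity a b (extendIcc q) s, extendIcc q s)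

theorem continuous_jetOf (q : C(Icc (0 : ℝ) 1, E)) : Continuous (jetOf a b q) :=
  (continuous_iff_continuousAt.2
    fun s => (hasDerivAt_pathPosition a b (continuous_extendIcc q) s).continuousAt).prodMk
  ((continuous_pathVelocity a b (continuous_extendIcc q)).prodMk (continuous_extendIcc q))

theorem jetOf_mem (ha : ‖a‖ < 6 / 5) (hb : ‖b‖ < 6 / 5) {q : C(Icc (0 : ℝ) 1, E)}
    (hq : ‖q‖ ≤ 1 / 10) {s : ℝ} (hs : s ∈ Icc (0 : ℝ) 1) :
    jetOf a b q s ∈ jetDomain E ∧ ‖(jetOf a b q s).2.1‖ ≤ 5 / 2 :=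
  mem_jetDomain_of_isC2Path (by rwa [pathPosition_zero])
    (by rwa [pathPosition_one a b (continuous_extendIcc q)])
    (isC2Path_pathPosition a b (continuous_extendIcc q))
    (fun _ => norm_extendIcc_le hq) hs

/-- Both paths have the endpoints a and b, so only the acceleration term of `IsC2Path.dist_le` is
left. -/
theorem dist_jetOf_le (q q' : C(Icc (0 : ℝ) 1, E)) {s : ℝ} (hs : s ∈ Icc (0 : ℝ) 1) :
    dist (jetOf a b q s) (jetOf a b q' s) ≤ dist q q' := by
  have hK : ∀ s ∈ Icc (0 : ℝ) 1, ‖extendIcc q s - extendIcc q' s‖ ≤ dist q q' := fun s hs => by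
    rw [extendIcc_apply q hs, extendIcc_apply q' hs, ← dist_eq_norm]
    exact ContinuousMap.dist_apply_le_dist _
  have h2 := (isC2Path_pathPosition a b (continuous_extendIcc q)).dist_le
    (isC2Path_pathPosition a b (continuous_extendIcc q')) hK hs
  rw [pathPosition_zero, pathPosition_zero, pathPosition_one a b (continuous_extendIcc q),
    pathPosition_one a b (continuous_extendIcc q')] at h2
  simpa only [sub_self, norm_zero, add_zero, mul_zero, zero_add, jetOf] using h2

/-- The acceleration that the force form prescribes. -/
def forceVector (f : E → ℝ) (h : E → E →L[ℝ] E →L[ℝ] ℝ) (p : E × E × E) : E :=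
  -(InnerProductSpace.toDual ℝ E).symm (forceForm f h p.1 p.2.1 p.2.2)

theorem inner_forceVector (p : E × E × E) (w : E) :
    inner ℝ (forceVector f h p) w + forceForm f h p.1 p.2.1 p.2.2 w = 0 := by
  rw [forceVector, inner_neg_left, InnerProductSpace.toDual_symm_apply, neg_add_cancel]

theorem norm_forceVector (p : E × E × E) :
    ‖forceVector f h p‖ = ‖forceForm f h p.1 p.2.1 p.2.2‖ := by
  rw [forceVector, norm_neg, LinearIsometryEquiv.norm_map]

theorem NearlyFlat.dist_forceVector_le (hfh : NearlyFlat f h ε) (hε : ε ≤ 1) {p p' : E × E × E}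
    (hp : p ∈ jetDomain E) (hp' : p' ∈ jetDomain E) :
    dist (forceVector f h p) (forceVector f h p') ≤ 20000 * ε * dist p p' := by
  rw [forceVector, forceVector, dist_neg_neg, LinearIsometryEquiv.dist_map, dist_eq_norm]
  exact (hfh.boundedLipschitz_forceForm hε).lip p hp p' hp'

theorem NearlyFlat.continuousOn_forceVector (hfh : NearlyFlat f h ε) (hε : ε ≤ 1) :
    ContinuousOn (forceVector f h) (jetDomain E) :=
  (LipschitzOnWith.of_dist_le_mul
    (K := ⟨20000 * ε, mul_nonneg (by norm_num) hfh.eps_nonneg⟩)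
    fun _ hp _ hp' => hfh.dist_forceVector_le hε hp hp').continuousOn

/-- Any two points of the ball of radius `6 / 5` are joined by a ray. -/
theorem exists_isRay (hfh : NearlyFlat f h ε) (hε : ε ≤ 1 / 1000000)
    (ha : ‖a‖ < 6 / 5) (hb : ‖b‖ < 6 / 5) :
    ∃ y v q : ℝ → E, IsRay f h y v q ∧ y 0 = a ∧ y 1 = b := by
  have hε0 := hfh.eps_nonneg
  -- The unknown of the fixed point problem is the acceleration; the endpoints are built into
  -- `jetOf`. The radius 1/10 is ample, since the prescribed acceleration is at most 4ε(1/10 +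
  -- 25/4).
  let B : Set C(Icc (0 : ℝ) 1, E) := Metric.closedBall 0 (1 / 10)
  have hB : ∀ q : B, ‖(q : C(Icc (0 : ℝ) 1, E))‖ ≤ 1 / 10 := fun q =>
    mem_closedBall_zero_iff.1 q.2
  have hcont : ∀ q : B, Continuous fun s : Icc (0 : ℝ) 1 => forceVector f h (jetOf a b q s) :=
    fun q => (hfh.continuousOn_forceVector (by linarith)).comp_continuous
      ((continuous_jetOf _).comp continuous_subtype_val) fun s => (jetOf_mem ha hb (hB q) s.2).1
  have hmem : ∀ q : B, (⟨_, hcont q⟩ : C(Icc (0 : ℝ) 1, E)) ∈ B := fun q => by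
    rw [mem_closedBall_zero_iff, ContinuousMap.norm_le _ (by norm_num)]
    intro s
    rw [ContinuousMap.coe_mk, norm_forceVector]
    obtain ⟨h1, h2⟩ := jetOf_mem ha hb (hB q) s.2
    refine (hfh.norm_forceForm_le (by linarith) h1.1 _ _).trans ?_
    have h4 := norm_extendIcc_le (hB q) s.2
    calc _ ≤ 4 * ε * (1 / 10 + (5 / 2) ^ 2) := by gcongr; exact h4
      _ ≤ 1 / 10 := by linarith
  let Φ : B → B := fun q => ⟨⟨_, hcont q⟩, hmem q⟩
  have hcontr : ContractingWith (1 / 2) Φ := by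
    refine ⟨by norm_num, LipschitzWith.of_dist_le_mul fun q q' => ?_⟩
    rw [Subtype.dist_eq, ContinuousMap.dist_le (by positivity)]
    intro s
    calc _ ≤ 20000 * ε * dist (jetOf a b q s) (jetOf a b q' s) :=
          hfh.dist_forceVector_le (by linarith) (jetOf_mem ha hb (hB q) s.2).1
            (jetOf_mem ha hb (hB q') s.2).1
      _ ≤ 20000 * ε * dist q q' := by gcongr; exact dist_jetOf_le _ _ s.2
      _ ≤ ((1 / 2 : NNReal) : ℝ) * dist q q' := by
          gcongr
          push_cast
          linarith
  have : CompleteSpace B := (Metric.isClosed_closedBall.isComplete).completeSpace_coe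
  have : Nonempty B := ⟨⟨0, by simp [B]⟩⟩
  obtain ⟨q₀, hfix⟩ : ∃ q₀, Φ q₀ = q₀ := ⟨_, hcontr.fixedPoint_isFixedPt⟩
  refine ⟨pathPosition a b (extendIcc q₀), pathVelocity a b (extendIcc q₀), extendIcc q₀,
    ⟨isC2Path_pathPosition a b (continuous_extendIcc q₀.1),
    fun s hs => (jetOf_mem ha hb (hB q₀) hs).1.1, fun s hs w => ?_⟩, pathPosition_zero a b _,
    pathPosition_one a b (continuous_extendIcc q₀.1)⟩
  have h1 : extendIcc q₀ s = forceVector f h (jetOf a b q₀ s) := by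
    rw [extendIcc_apply _ hs]
    exact (DFunLike.congr_fun (congrArg Subtype.val hfix) ⟨s, hs⟩).symm
  have h2 := inner_forceVector (f := f) (h := h) (jetOf a b q₀ s) w
  rwa [← h1] at h2

end Existence
end

/-! ### Travel time as a function of the endpoints -/

noncomputable section

variable {E : Type*} [NormedAddCommGroup E] [InnerProductSpace ℝ E]
  {f : E → ℝ} {h : E → E →L[ℝ] E →L[ℝ] ℝ} {ε : ℝ}

theorem BoundedLipschitz.mono_set {α G : Type*} [PseudoMetricSpace α] [SeminormedAddCommGroup G]
    {s t : Set α} {c : ℝ} {F : α → G} (hF : BoundedLipschitz t c F) (hst : s ⊆ t) :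
    BoundedLipschitz s c F :=
  ⟨fun p hp => hF.bound p (hst hp), fun p hp p' hp' => hF.lip p (hst hp) p' (hst hp')⟩

/-- The equation of the ray tested on w = v is half the derivative of f·h(v, v). -/
theorem NearlyFlat.hasDerivWithinAt_energy (hfh : NearlyFlat f h ε) {y v q : ℝ → E}
    (hy : IsRay f h y v q) {s : ℝ} (hs : s ∈ Icc (0 : ℝ) 1) :
    HasDerivWithinAt (fun s => f (y s) * h (y s) (v s) (v s)) 0 (Icc 0 1) s := by
  have hx := hy.mem s hs
  have h1 : HasDerivWithinAt (fun s => f (y s)) (fderiv ℝ f (y s) (v s)) (Icc 0 1) s :=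
    (hfh.differentiable_lapse _ hx).hasFDerivAt.comp_hasDerivWithinAt s (hy.velocity s hs)
  have h2 : HasDerivWithinAt (fun s => h (y s)) (fderiv ℝ h (y s) (v s)) (Icc 0 1) s :=
    (hfh.differentiable_metric _ hx).hasFDerivAt.comp_hasDerivWithinAt s (hy.velocity s hs)
  have h3 := h1.mul ((h2.clm_apply (hy.acceleration s hs)).clm_apply (hy.acceleration s hs))
  refine h3.congr_deriv ?_
  have h4 := hy.equation s hs (v s)
  rw [inner_add_forceForm] at h4
  have h5 := hfh.symm _ hx (v s) (q s)
  simp only [add_apply, h5]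
  linarith

/-- The square of the energy of a ray is conserved. -/
theorem IsRay.energy_eq (hfh : NearlyFlat f h ε) {y v q : ℝ → E} (hy : IsRay f h y v q) {s : ℝ}
    (hs : s ∈ Icc (0 : ℝ) 1) :
    f (y s) * h (y s) (v s) (v s) = f (y 0) * h (y 0) (v 0) (v 0) := by
  have h1 := (convex_Icc (0 : ℝ) 1).norm_image_sub_le_of_norm_hasDerivWithin_le (C := 0)
    (fun s hs => hfh.hasDerivWithinAt_energy hy hs) (by simp) (left_mem_Icc.2 zero_le_one) hs
  rw [zero_mul, norm_le_zero_iff, sub_eq_zero] at h1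
  exact h1

/-- The square of the coordinate time that light takes along a ray. -/
def travelTimeSq (f : E → ℝ) (h : E → E →L[ℝ] E →L[ℝ] ℝ) (y v : ℝ → E) : ℝ :=
  f (y 0) * h (y 0) (v 0) (v 0) * (∫ s in (0 : ℝ)..1, (f (y s))⁻¹) ^ 2

theorem IsRay.travelTimeSq_congr (hfh : NearlyFlat f h ε) (hε : ε ≤ 1 / 1000000)
    {y v q y' v' q' : ℝ → E} (hy : IsRay f h y v q) (hy' : IsRay f h y' v' q')
    (h0 : y 0 = y' 0) (h1 : y 1 = y' 1) :
    travelTimeSq f h y v = travelTimeSq f h y' v' := by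
  have key := fun (s : ℝ) hs => hy.eqOn hfh hε hy' h0 h1 (s := s) hs
  have hv := (key 0 (left_mem_Icc.2 zero_le_one)).2
  have hint : ∫ s in (0 : ℝ)..1, (f (y s))⁻¹ = ∫ s in (0 : ℝ)..1, (f (y' s))⁻¹ :=
    intervalIntegral.integral_congr fun s hs => by
      rw [uIcc_of_le zero_le_one] at hs
      simp only [(key s hs).1]
  rw [travelTimeSq, travelTimeSq, h0, hv, hint]

/-- The force is quadratic in the velocity; hence rays can be run backwards. -/
theorem forceForm_neg (x v q : E) : forceForm f h x (-v) q = forceForm f h x v q := by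
  ext w
  simp [forceForm, sub_eq_add_neg]

theorem IsRay.reverse {y v q : ℝ → E} (hy : IsRay f h y v q) :
    IsRay f h (fun s => y (1 - s)) (fun s => -v (1 - s)) (fun s => q (1 - s)) := by
  have hmaps : MapsTo (fun s : ℝ => 1 - s) (Icc 0 1) (Icc 0 1) := fun s hs =>
    ⟨by linarith [hs.2], by linarith [hs.1]⟩
  have hd : ∀ s : ℝ, HasDerivWithinAt (fun s : ℝ => 1 - s) (-1) (Icc 0 1) s := fun s => by
    simpa using (hasDerivWithinAt_id s (Icc (0 : ℝ) 1)).const_sub 1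
  refine ⟨⟨fun s hs => ?_, fun s hs => ?_, hy.continuousOn.comp (by fun_prop) hmaps⟩,
    fun s hs => hy.mem _ (hmaps hs), fun s hs w => ?_⟩
  · have := (hy.velocity _ (hmaps hs)).scomp s (hd s) hmaps
    rwa [neg_one_smul] at this
  · have := ((hy.acceleration _ (hmaps hs)).scomp s (hd s) hmaps).neg
    rwa [neg_one_smul, neg_neg] at this
  · rw [forceForm_neg]
    exact hy.equation _ (hmaps hs) w

/-- Reversal replaces the energy at 0 by the energy at 1, equal by conservation, and does not change
∫ 1/f. -/
theorem IsRay.travelTimeSq_reverse (hfh : NearlyFlat f h ε) {y v q : ℝ → E}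
    (hy : IsRay f h y v q) :
    travelTimeSq f h (fun s => y (1 - s)) (fun s => -v (1 - s)) = travelTimeSq f h y v := by
  have h1 := intervalIntegral.integral_comp_sub_left (a := 0) (b := 1) (fun s => (f (y s))⁻¹) 1
  rw [sub_self, sub_zero] at h1
  simp only [travelTimeSq, sub_zero, h1, map_neg, neg_apply, neg_neg]
  rw [hy.energy_eq hfh (right_mem_Icc.2 zero_le_one)]

theorem IsRay.continuousOn_inv_lapse (hfh : NearlyFlat f h ε) (hε : ε ≤ 1 / 2) {y v q : ℝ → E}
    (hy : IsRay f h y v q) : ContinuousOn (fun s => (f (y s))⁻¹) (Icc 0 1) := by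
  refine ContinuousOn.inv₀ (fun s hs => ?_) fun s hs => (hfh.lapse_pos hε (hy.mem s hs)).ne'
  exact (hfh.differentiable_lapse _ (hy.mem s hs)).continuousAt.comp_continuousWithinAt
    (hy.continuousOn_position s hs)

theorem IsRay.intervalIntegrable_inv_lapse (hfh : NearlyFlat f h ε) (hε : ε ≤ 1 / 2)
    {y v q : ℝ → E} (hy : IsRay f h y v q) :
    IntervalIntegrable (fun s => (f (y s))⁻¹) MeasureTheory.volume 0 1 :=
  ContinuousOn.intervalIntegrable (by
    rw [uIcc_of_le zero_le_one]; exact hy.continuousOn_inv_lapse hfh hε)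

theorem abs_integral_le_of_forall {F : ℝ → ℝ} {C : ℝ} (hF : ∀ s ∈ Icc (0 : ℝ) 1, |F s| ≤ C) :
    |∫ s in (0 : ℝ)..1, F s| ≤ C := by
  have := intervalIntegral.norm_integral_le_of_norm_le_const (a := 0) (b := 1) (f := F) (C := C)
    (fun s hs => by
      rw [uIoc_of_le zero_le_one] at hs
      exact hF s (Ioc_subset_Icc_self hs))
  simpa using this

theorem NearlyFlat.abs_inv_lapse_sub_le (hfh : NearlyFlat f h ε) (hε : ε ≤ 1 / 2) {x x' : E}
    (hx : x ∈ Metric.ball (0 : E) 2) (hx' : x' ∈ Metric.ball (0 : E) 2) :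
    |(f x)⁻¹ - (f x')⁻¹| ≤ 4 * ε * ‖x - x'‖ := by
  have h1 := hfh.lapse_ge hε hx
  have h2 := hfh.lapse_ge hε hx'
  have h3 := hfh.boundedLipschitz_lapse.lip x' hx' x hx
  rw [sub_sub_sub_cancel_right, dist_comm, dist_eq_norm, Real.norm_eq_abs] at h3
  have h0 := hfh.eps_nonneg
  have hp : 0 < f x := by linarith
  have hp' : 0 < f x' := by linarith
  rw [inv_sub_inv hp.ne' hp'.ne', abs_div, abs_of_pos (mul_pos hp hp'),
    div_le_iff₀ (mul_pos hp hp')]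
  have h5 : 1 / 4 ≤ f x * f x' := by nlinarith
  have h6 : 0 ≤ 4 * ε * ‖x - x'‖ := by positivity
  nlinarith

theorem NearlyFlat.abs_inv_lapse_sub_one_le (hfh : NearlyFlat f h ε) (hε : ε ≤ 1 / 2) {x : E}
    (hx : x ∈ Metric.ball (0 : E) 2) : |(f x)⁻¹ - 1| ≤ 2 * ε := by
  have h1 := hfh.lapse_ge hε hx
  have h3 := hfh.abs_lapse_sub_one_le hx
  have h0 := hfh.eps_nonneg
  have h2 : (f x)⁻¹ - 1 = (1 - f x) / f x := by field_simp
  rw [h2, abs_div, abs_of_pos (by positivity : 0 < f x), div_le_iff₀ (by positivity), abs_sub_comm]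
  nlinarith

/-- The domain of the pairs of endpoints. -/
def endpointDomain (E : Type*) [NormedAddCommGroup E] : Set (E × E) :=
  Metric.ball 0 (6 / 5) ×ˢ Metric.ball 0 (6 / 5)

section Family

variable {y v q : E × E → ℝ → E}

/-- A choice of a ray for each pair of endpoints. -/
def IsRayFamily (f : E → ℝ) (h : E → E →L[ℝ] E →L[ℝ] ℝ) (y v q : E × E → ℝ → E) : Prop :=
  ∀ p ∈ endpointDomain E, IsRay f h (y p) (v p) (q p) ∧ y p 0 = p.1 ∧ y p 1 = p.2

theorem IsRayFamily.norm_acceleration_sub_le (hfh : NearlyFlat f h ε) (hε : ε ≤ 1 / 1000000)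
    (hF : IsRayFamily f h y v q) {p p' : E × E} (hp : p ∈ endpointDomain E)
    (hp' : p' ∈ endpointDomain E) {s : ℝ} (hs : s ∈ Icc (0 : ℝ) 1) :
    ‖q p s - q p' s‖ ≤ 160000 * ε * dist p p' := by
  have h0 := hfh.eps_nonneg
  obtain ⟨hr, hr0, hr1⟩ := hF p hp
  obtain ⟨hr', hr0', hr1'⟩ := hF p' hp'
  refine (hr.norm_acceleration_sub_le hfh hε hr' hs).trans ?_
  rw [hr0, hr1, hr0', hr1']
  have h1 : ‖p.1 - p'.1‖ ≤ dist p p' := by rw [← dist_eq_norm]; exact le_max_left _ _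
  have h2 : ‖p.2 - p'.2‖ ≤ dist p p' := by rw [← dist_eq_norm]; exact le_max_right _ _
  calc _ ≤ 80000 * ε * (dist p p' + dist p p') := by gcongr
    _ = _ := by ring

theorem IsRayFamily.norm_position_sub_le (hfh : NearlyFlat f h ε) (hε : ε ≤ 1 / 1000000)
    (hF : IsRayFamily f h y v q) {p p' : E × E} (hp : p ∈ endpointDomain E)
    (hp' : p' ∈ endpointDomain E) {s : ℝ} (hs : s ∈ Icc (0 : ℝ) 1) :
    ‖y p s - y p' s‖ ≤ 5 * dist p p' := by
  have h0 := hfh.eps_nonneg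
  obtain ⟨hr, hr0, hr1⟩ := hF p hp
  obtain ⟨hr', hr0', hr1'⟩ := hF p' hp'
  have h3 := hr.toIsC2Path.dist_le hr'.toIsC2Path
    (fun s hs => hF.norm_acceleration_sub_le hfh hε hp hp' hs) hs
  rw [hr0, hr1, hr0', hr1'] at h3
  have h1 : ‖p.1 - p'.1‖ ≤ dist p p' := by rw [← dist_eq_norm]; exact le_max_left _ _
  have h2 : ‖p.2 - p'.2‖ ≤ dist p p' := by rw [← dist_eq_norm]; exact le_max_right _ _
  have h4 : ‖y p s - y p' s‖ ≤ dist (y p s, v p s, q p s) (y p' s, v p' s, q p' s) := by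
    rw [← dist_eq_norm]; exact le_max_left _ _
  have h5 : 160000 * ε * dist p p' ≤ 1 * dist p p' := by gcongr; linarith
  linarith

theorem IsRayFamily.boundedLipschitz_velocity (hfh : NearlyFlat f h ε) (hε : ε ≤ 1 / 1000000)
    (hF : IsRayFamily f h y v q) :
    BoundedLipschitz (endpointDomain E) (160000 * ε) (fun p => v p 0 - (p.2 - p.1)) := by
  have h0 := hfh.eps_nonneg
  refine ⟨fun p hp => ?_, fun p hp p' hp' => ?_⟩
  · obtain ⟨hr, hr0, hr1⟩ := hF p hp
    have := hr.norm_velocity_sub_chord_le (fun s hs => hr.norm_acceleration_le' hfh hε hs)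
      (left_mem_Icc.2 zero_le_one)
    rw [hr0, hr1] at this
    linarith
  · obtain ⟨hr, hr0, hr1⟩ := hF p hp
    obtain ⟨hr', hr0', hr1'⟩ := hF p' hp'
    have := (hr.toIsC2Path.sub hr'.toIsC2Path).norm_velocity_sub_chord_le
      (fun s hs => hF.norm_acceleration_sub_le hfh hε hp hp' hs) (left_mem_Icc.2 zero_le_one)
    rw [hr0, hr1, hr0', hr1'] at this
    have e : v p 0 - (p.2 - p.1) - (v p' 0 - (p'.2 - p'.1))
        = v p 0 - v p' 0 - (p.2 - p'.2 - (p.1 - p'.1)) := by abel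
    rwa [e]

theorem IsRayFamily.boundedLipschitz_time (hfh : NearlyFlat f h ε) (hε : ε ≤ 1 / 1000000)
    (hF : IsRayFamily f h y v q) :
    BoundedLipschitz (endpointDomain E) (20 * ε)
      (fun p => (∫ s in (0 : ℝ)..1, (f (y p s))⁻¹) - 1) := by
  have h0 := hfh.eps_nonneg
  have hε' : ε ≤ 1 / 2 := by linarith
  refine ⟨fun p hp => ?_, fun p hp p' hp' => ?_⟩
  · obtain ⟨hr, -, -⟩ := hF p hp
    have h1 : (∫ s in (0 : ℝ)..1, (f (y p s))⁻¹) - 1 = ∫ s in (0 : ℝ)..1, ((f (y p s))⁻¹ - 1) := by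
      rw [intervalIntegral.integral_sub (hr.intervalIntegrable_inv_lapse hfh hε')
        intervalIntegrable_const]
      simp
    rw [h1, Real.norm_eq_abs]
    refine (abs_integral_le_of_forall
      fun s hs => hfh.abs_inv_lapse_sub_one_le hε' (hr.mem s hs)).trans (by linarith)
  · obtain ⟨hr, -, -⟩ := hF p hp
    obtain ⟨hr', -, -⟩ := hF p' hp'
    rw [sub_sub_sub_cancel_right, ← intervalIntegral.integral_sub
      (hr.intervalIntegrable_inv_lapse hfh hε') (hr'.intervalIntegrable_inv_lapse hfh hε'),
      Real.norm_eq_abs]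
    refine abs_integral_le_of_forall fun s hs => ?_
    refine (hfh.abs_inv_lapse_sub_le hε' (hr.mem s hs) (hr'.mem s hs)).trans ?_
    calc _ ≤ 4 * ε * (5 * dist p p') := by
          gcongr
          exact hF.norm_position_sub_le hfh hε hp hp' hs
      _ = _ := by ring

theorem IsRayFamily.boundedLipschitz_travelTimeSq (hfh : NearlyFlat f h ε)
    (hε : ε ≤ 1 / 1000000) (hF : IsRayFamily f h y v q) :
    BoundedLipschitz (endpointDomain E) (3000000 * ε)
      (fun p => travelTimeSq f h (y p) (v p) - inner ℝ (p.2 - p.1) (p.2 - p.1)) := by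
  have h0 := hfh.eps_nonneg
  have hball : Metric.ball (0 : E) (6 / 5) ⊆ Metric.ball 0 2 :=
    Metric.ball_subset_ball (by norm_num)
  have hδ := hF.boundedLipschitz_velocity hfh hε
  have hk := hF.boundedLipschitz_time hfh hε
  have hid : BoundedLipschitz (Metric.ball (0 : E) (6 / 5)) (6 / 5) (fun x => x) :=
    (boundedLipschitz_id (by norm_num)).mono_set Metric.ball_subset_closedBall
  have hchord : BoundedLipschitz (endpointDomain E) 3 (fun p => p.2 - p.1) :=
    ((boundedLipschitz_comp_snd (by norm_num) hid).sub
      (boundedLipschitz_comp_fst (by norm_num) hid)).mono (by norm_num)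
  have hv : BoundedLipschitz (endpointDomain E) 4 (fun p => v p 0) :=
    ((hδ.add hchord).mono (by linarith)).congr (fun p _ => by abel)
  have hf1 : BoundedLipschitz (endpointDomain E) ε (fun p => f p.1 - 1) :=
    boundedLipschitz_comp_fst h0 (hfh.boundedLipschitz_lapse.mono_set hball)
  have hh1 : BoundedLipschitz (endpointDomain E) ε (fun p => h p.1 - innerForm E) :=
    boundedLipschitz_comp_fst h0 (hfh.boundedLipschitz_metric.mono_set hball)
  have hh2 : BoundedLipschitz (endpointDomain E) 2 (fun p => h p.1) :=
    boundedLipschitz_comp_fst (by norm_num)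
      ((hfh.boundedLipschitz_metric_two (by linarith)).mono_set hball)
  have hk1 := (hk.add (.const (1 : ℝ) (c := 1) (by norm_num))).mono (b := 2) (by linarith)
  have hk2 := (hk.add (.const (2 : ℝ) (c := 2) (by norm_num))).mono (b := 3) (by linarith)
  -- Let k = ∫ 1/f − 1, v the initial velocity, c the chord and δ = v − c. The difference is ((f −
  -- 1)(1 + k)² + k(k + 2))·h(v, v) + (h − ⟨·, ·⟩)(v, v) + ⟨δ, v⟩ + ⟨c, δ⟩, where f − 1, k, h − ⟨·,
  -- ·⟩ and δ are of order ε.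
  have u1 := (hf1.mul (hk1.mul hk1 (by norm_num) (by norm_num)) h0 (by norm_num)).add
    (hk.mul hk2 (by positivity) (by norm_num))
  have u2 := (hh2.clm_apply hv (by norm_num) (by norm_num)).clm_apply hv (by norm_num)
    (by norm_num)
  have u3 := (hh1.clm_apply hv h0 (by norm_num)).clm_apply hv (by positivity) (by norm_num)
  have u4 := hδ.inner hv (by positivity) (by norm_num)
  have u5 := hchord.inner hδ (by norm_num) (by positivity)
  refine (((((u1.mul u2 (by positivity) (by norm_num)).add u3).add u4).add u5).mono
    (by linarith)).congr fun p hp => ?_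
  simp only [travelTimeSq, (hF p hp).2.1, sub_apply, innerForm_apply, inner_sub_left,
    inner_sub_right]
  rw [real_inner_comm (v p 0) p.1, real_inner_comm (v p 0) p.2]
  ring

end Family

/-- The squared travel time as a function of the endpoints: it is symmetric, and `C¹`-close to the
squared Euclidean distance. -/
theorem NearlyFlat.exists_travelTimeSq [CompleteSpace E] (hfh : NearlyFlat f h ε)
    (hε : ε ≤ 1 / 1000000) :
    ∃ Θ : E → E → ℝ,
      (∀ y v q : ℝ → E, IsRay f h y v q → ‖y 0‖ < 6 / 5 → ‖y 1‖ < 6 / 5 →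
        travelTimeSq f h y v = Θ (y 0) (y 1)) ∧
      (∀ a b, ‖a‖ < 6 / 5 → ‖b‖ < 6 / 5 → Θ a b = Θ b a) ∧
      BoundedLipschitz (endpointDomain E) (3000000 * ε)
        (fun p => Θ p.1 p.2 - inner ℝ (p.2 - p.1) (p.2 - p.1)) := by
  have hex : ∀ p : E × E, ∃ y v q : ℝ → E, p ∈ endpointDomain E →
      IsRay f h y v q ∧ y 0 = p.1 ∧ y 1 = p.2 := fun p => by
    by_cases hp : p ∈ endpointDomain E
    · obtain ⟨y, v, q, h1, h2, h3⟩ := exists_isRay hfh hε (mem_ball_zero_iff.1 hp.1)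
        (mem_ball_zero_iff.1 hp.2)
      exact ⟨y, v, q, fun _ => ⟨h1, h2, h3⟩⟩
    · exact ⟨0, 0, 0, fun h => absurd h hp⟩
  choose y v q hF using hex
  have hmem : ∀ {a b : E}, ‖a‖ < 6 / 5 → ‖b‖ < 6 / 5 → (a, b) ∈ endpointDomain E :=
    fun ha hb => ⟨mem_ball_zero_iff.2 ha, mem_ball_zero_iff.2 hb⟩
  have hval : ∀ y' v' q' : ℝ → E, IsRay f h y' v' q' → ‖y' 0‖ < 6 / 5 → ‖y' 1‖ < 6 / 5 →
      travelTimeSq f h y' v' = travelTimeSq f h (y (y' 0, y' 1)) (v (y' 0, y' 1)) :=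
    fun y' v' q' hr h0 h1 => by
      obtain ⟨hr', e0, e1⟩ := hF _ (hmem h0 h1)
      exact hr.travelTimeSq_congr hfh hε hr' e0.symm e1.symm
  refine ⟨fun a b => travelTimeSq f h (y (a, b)) (v (a, b)), hval, fun a b ha hb => ?_,
    IsRayFamily.boundedLipschitz_travelTimeSq hfh hε hF⟩
  obtain ⟨hr, e0, e1⟩ := hF _ (hmem ha hb)
  -- The reversed ray joins b to a, so its travel time computes Θ b a.
  have h1 := hval _ _ _ hr.reverse (by simpa [e1] using hb) (by simpa [e0] using ha)
  rw [hr.travelTimeSq_reverse hfh] at h1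
  simpa [e0, e1] using h1
end

/-! ### Tetrahedra with prescribed edges -/

noncomputable section

section Tetrahedron

variable {E : Type*} [NormedAddCommGroup E] [InnerProductSpace ℝ E]

/-- The squared lengths of the six edges of the tetrahedron with vertices `0` and `X i`. -/
def edgesSq (X : Fin 3 → E) : (Fin 3 → ℝ) × (Fin 3 → ℝ) :=
  (fun i => ‖X i‖ ^ 2, fun i => ‖X (i + 1) - X i‖ ^ 2)

/-- The derivative of `edgesSq` at `X`. -/
def edgesSqDeriv (X : Fin 3 → E) : (Fin 3 → E) →L[ℝ] (Fin 3 → ℝ) × (Fin 3 → ℝ) :=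
  (ContinuousLinearMap.pi fun i =>
    (2 • innerSL ℝ (X i)) ∘L ContinuousLinearMap.proj (R := ℝ) (φ := fun _ : Fin 3 => E) i).prod
  (ContinuousLinearMap.pi fun i =>
    (2 • innerSL ℝ (X (i + 1) - X i)) ∘L
      (ContinuousLinearMap.proj (R := ℝ) (φ := fun _ : Fin 3 => E) (i + 1)
        - ContinuousLinearMap.proj (R := ℝ) (φ := fun _ : Fin 3 => E) i))

theorem hasStrictFDerivAt_edgesSq (X : Fin 3 → E) :
    HasStrictFDerivAt edgesSq (edgesSqDeriv X) X := by
  refine HasStrictFDerivAt.prodMk (hasStrictFDerivAt_pi.2 fun i => ?_)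
    (hasStrictFDerivAt_pi.2 fun i => ?_)
  · exact (hasStrictFDerivAt_norm_sq (X i)).comp X
      (ContinuousLinearMap.proj (R := ℝ) (φ := fun _ : Fin 3 => E) i).hasStrictFDerivAt
  · exact (hasStrictFDerivAt_norm_sq (X (i + 1) - X i)).comp X
      (ContinuousLinearMap.proj (R := ℝ) (φ := fun _ : Fin 3 => E) (i + 1)
        - ContinuousLinearMap.proj (R := ℝ) (φ := fun _ : Fin 3 => E) i).hasStrictFDerivAt

variable {X Y : Fin 3 → E}

theorem linearIndependent_of_biorthogonal
    (hXY : ∀ i j, inner ℝ (X i) (Y j) = if i = j then (1 : ℝ) else 0) :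
    LinearIndependent ℝ X := by
  rw [Fintype.linearIndependent_iff]
  intro g hg i
  have h1 : inner ℝ (∑ j, g j • X j) (Y i) = (0 : ℝ) := by rw [hg, inner_zero_left]
  simpa [sum_inner, inner_smul_left, hXY] using h1

/-- The dual basis Y yields variations Z with arbitrary products A i j = ⟨X i, Z j⟩. A symmetric A
suffices: the diagonal is fixed by α, and then β i fixes the entry m i of the pair {i, i + 1}.
Indices run modulo 3, so these pairs are all pairs. -/
theorem surjective_edgesSqDeriv
    (hXY : ∀ i j, inner ℝ (X i) (Y j) = if i = j then (1 : ℝ) else 0) :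
    Function.Surjective (edgesSqDeriv X) := by
  rintro ⟨α, β⟩
  let m : Fin 3 → ℝ := fun i => (α i + α (i + 1) - β i) / 4
  let A : Fin 3 → Fin 3 → ℝ := fun i j =>
    if i = j then α i / 2 else if j = i + 1 then m i else m j
  have hA : ∀ i j, inner ℝ (X i) (∑ k, A k j • Y k) = A i j := fun i j => by
    simp [inner_sum, inner_smul_right, hXY]
  refine ⟨fun j => ∑ k, A k j • Y k, ?_⟩
  ext i
  · change (2 • innerSL ℝ (X i)) (∑ k, A k i • Y k) = α i
    rw [smul_apply, innerSL_apply_apply, hA]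
    simp only [A, if_true, nsmul_eq_mul]
    push_cast
    ring
  · change (2 • innerSL ℝ (X (i + 1) - X i)) (∑ k, A k (i + 1) • Y k - ∑ k, A k i • Y k) = β i
    rw [smul_apply, innerSL_apply_apply, inner_sub_left, inner_sub_right, inner_sub_right,
      hA, hA, hA, hA, nsmul_eq_mul]
    have h1 : A (i + 1) i = m i := by
      fin_cases i <;> simp [A]
    have h2 : A i (i + 1) = m i := by
      fin_cases i <;> simp [A]
    have h3 : ∀ j, A j j = α j / 2 := fun j => by simp [A]
    rw [h1, h2, h3, h3]
    simp only [m]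
    push_cast
    ring

theorem affineIndependent_cons_zero (hX : LinearIndependent ℝ X) :
    AffineIndependent ℝ (Fin.cons 0 X : Fin 4 → E) := by
  rw [affineIndependent_iff_linearIndependent_vsub ℝ _ (0 : Fin 4),
    ← linearIndependent_equiv (finSuccAboveEquiv (0 : Fin 4))]
  have e : (fun i : {i : Fin 4 // i ≠ 0} =>
      (Fin.cons 0 X : Fin 4 → E) i -ᵥ (Fin.cons 0 X : Fin 4 → E) 0) ∘
        finSuccAboveEquiv (0 : Fin 4) = X := by
    ext i
    simp [finSuccAboveEquiv_apply]
  rw [e]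
  exact hX

end Tetrahedron

/-- Three edges from the origin of a regular tetrahedron with unit edges. -/
def regularVertex : Fin 3 → EuclideanSpace ℝ (Fin 3) :=
  ![(√2)⁻¹ • !₂[1, 1, 0], (√2)⁻¹ • !₂[0, 1, 1], (√2)⁻¹ • !₂[1, 0, 1]]

/-- The dual basis of `regularVertex`. -/
def regularCovertex : Fin 3 → EuclideanSpace ℝ (Fin 3) :=
  ![(√2)⁻¹ • !₂[1, 1, -1], (√2)⁻¹ • !₂[-1, 1, 1], (√2)⁻¹ • !₂[1, -1, 1]]

theorem inv_sqrt_two_mul_self : (√2)⁻¹ * (√2)⁻¹ = (1 / 2 : ℝ) := by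
  rw [← mul_inv, Real.mul_self_sqrt (by norm_num)]
  norm_num

theorem inner_smul_vec (c a₀ a₁ a₂ b₀ b₁ b₂ : ℝ) :
    inner ℝ (c • !₂[a₀, a₁, a₂]) (c • !₂[b₀, b₁, b₂])
      = (c * c) * (a₀ * b₀ + a₁ * b₁ + a₂ * b₂) := by
  simp [inner_smul_left, inner_smul_right, PiLp.inner_apply, Fin.sum_univ_three]
  ring

theorem inner_regularVertex_regularCovertex (i j : Fin 3) :
    inner ℝ (regularVertex i) (regularCovertex j) = if i = j then (1 : ℝ) else 0 := by
  fin_cases i <;> fin_cases j <;>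
    simp [regularVertex, regularCovertex, inner_smul_vec, inv_sqrt_two_mul_self] <;> norm_num

theorem edgesSq_regularVertex : edgesSq regularVertex = (fun _ => 1, fun _ => 1) := by
  simp only [edgesSq, ← real_inner_self_eq_norm_sq, inner_sub_left, inner_sub_right]
  refine Prod.ext (funext fun i => ?_) (funext fun i => ?_) <;>
  fin_cases i <;>
    simp [regularVertex, inner_smul_vec, inv_sqrt_two_mul_self,
      -inner_self_eq_norm_sq_to_K] <;> norm_num

/-- A map approximated by a surjective linear map, with error constant below the inverse norm of a
right inverse, covers a ball of explicit radius. Passing from squared lengths to Θ raises the error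
constant by at most δ, and Θ need not be differentiable. -/
theorem exists_regular_tetrahedron :
    ∃ δ : ℝ, 0 < δ ∧ ∀ Θ : EuclideanSpace ℝ (Fin 3) → EuclideanSpace ℝ (Fin 3) → ℝ,
      (∀ a b, ‖a‖ < 6 / 5 → ‖b‖ < 6 / 5 → Θ a b = Θ b a) →
      BoundedLipschitz (endpointDomain (EuclideanSpace ℝ (Fin 3))) δ
        (fun p => Θ p.1 p.2 - inner ℝ (p.2 - p.1) (p.2 - p.1)) →
      ∀ ℓ : ℝ, |ℓ - 1| ≤ δ →
      ∃ x : Fin 4 → EuclideanSpace ℝ (Fin 3), x 0 = 0 ∧ (∀ i, ‖x i‖ < 6 / 5) ∧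
        AffineIndependent ℝ x ∧ ∀ i j, i ≠ j → Θ (x i) (x j) = ℓ := by
  have hbi := inner_regularVertex_regularCovertex
  obtain ⟨g, hg⟩ := (edgesSqDeriv regularVertex).exists_nonlinearRightInverse_of_surjective
    (LinearMap.range_eq_top.2 (surjective_edgesSqDeriv hbi))
  set c : NNReal := g.nnnorm⁻¹ with hc
  have hc0 : 0 < c := inv_pos.2 hg
  -- Of the admissible error c, one third is allotted to the nonlinearity of `edgesSq` and one third
  -- to the deviation of Θ; the last third is the margin.
  obtain ⟨s, hs, happ⟩ := (hasStrictFDerivAt_edgesSq regularVertex).approximates_deriv_on_nhds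
    (c := c / 3) (Or.inr (by positivity))
  have hLI : {X : Fin 3 → EuclideanSpace ℝ (Fin 3) | LinearIndependent ℝ X} ∈
      nhds regularVertex :=
    isOpen_setOfPred_linearIndependent.mem_nhds (linearIndependent_of_biorthogonal hbi)
  have hnorm : {X : Fin 3 → EuclideanSpace ℝ (Fin 3) | ∀ i, ‖X i‖ < 6 / 5} ∈
      nhds regularVertex := by
    have hopen : IsOpen {X : Fin 3 → EuclideanSpace ℝ (Fin 3) | ∀ i, ‖X i‖ < 6 / 5} := by
      simp only [ofPred_forall]
      exact isOpen_iInter_of_finite fun i =>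
        isOpen_lt (continuous_apply i).norm continuous_const
    refine hopen.mem_nhds fun i => ?_
    have h1 : ‖regularVertex i‖ ^ 2 = 1 := congrFun (congrArg Prod.fst edgesSq_regularVertex) i
    nlinarith [norm_nonneg (regularVertex i)]
  obtain ⟨r, hr0, hr⟩ := Metric.nhds_basis_closedBall.mem_iff.1
    (Filter.inter_mem hs (Filter.inter_mem hLI hnorm))
  have hc0' : (0 : ℝ) < c := hc0
  -- The covered ball has radius at least (c/3)·r ≥ 2δ. The target is within 2δ of its centre: δ is
  -- due to ℓ and δ to Θ.
  refine ⟨min (c / 3) (c / 6 * r), by positivity, fun Θ hsymm hΘ ℓ hℓ => ?_⟩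
  set δ : ℝ := min (c / 3) (c / 6 * r) with hδ
  have hδ0 : 0 ≤ δ := by positivity
  set η : EuclideanSpace ℝ (Fin 3) × EuclideanSpace ℝ (Fin 3) → ℝ :=
    fun p => Θ p.1 p.2 - inner ℝ (p.2 - p.1) (p.2 - p.1) with hη
  -- Squared lengths plus deviations: G lists the values of Θ on the six edges.
  let G : (Fin 3 → EuclideanSpace ℝ (Fin 3)) → (Fin 3 → ℝ) × (Fin 3 → ℝ) :=
    fun X => edgesSq X + (fun i => η (0, X i), fun i => η (X i, X (i + 1)))
  have hdom : ∀ X ∈ Metric.closedBall regularVertex r, ∀ i,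
      (0, X i) ∈ endpointDomain (EuclideanSpace ℝ (Fin 3)) ∧
      (X i, X (i + 1)) ∈ endpointDomain (EuclideanSpace ℝ (Fin 3)) := fun X hX i => by
    have h1 := (hr hX).2.2
    exact ⟨⟨by simp, by simpa using h1 i⟩, ⟨by simpa using h1 i, by simpa using h1 (i + 1)⟩⟩
  have hG : ApproximatesLinearOn G (edgesSqDeriv regularVertex)
      (Metric.closedBall regularVertex r) (c / 3 + δ.toNNReal) := by
    intro X hX X' hX'
    have h1 := happ X (hr hX).1 X' (hr hX').1
    have h2 : ‖((fun i => η (0, X i), fun i => η (X i, X (i + 1))) : (Fin 3 → ℝ) × (Fin 3 → ℝ))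
        - (fun i => η (0, X' i), fun i => η (X' i, X' (i + 1)))‖ ≤ δ * ‖X - X'‖ := by
      refine max_le ((pi_norm_le_iff_of_nonneg (by positivity)).2 fun i => ?_)
        ((pi_norm_le_iff_of_nonneg (by positivity)).2 fun i => ?_)
      · refine (hΘ.lip _ (hdom X hX i).1 _ (hdom X' hX' i).1).trans ?_
        gcongr
        rw [Prod.dist_eq, dist_self, ← dist_eq_norm]
        exact max_le dist_nonneg (dist_le_pi_dist X X' i)
      · refine (hΘ.lip _ (hdom X hX i).2 _ (hdom X' hX' i).2).trans ?_
        gcongr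
        rw [Prod.dist_eq, ← dist_eq_norm]
        exact max_le (dist_le_pi_dist X X' i) (dist_le_pi_dist X X' (i + 1))
    have h3 : G X - G X' - edgesSqDeriv regularVertex (X - X')
        = (edgesSq X - edgesSq X' - edgesSqDeriv regularVertex (X - X'))
          + ((fun i => η (0, X i), fun i => η (X i, X (i + 1)))
            - (fun i => η (0, X' i), fun i => η (X' i, X' (i + 1)))) := by
      simp only [G]; abel
    rw [h3, NNReal.coe_add, Real.coe_toNNReal δ hδ0, add_mul]
    exact (norm_add_le _ _).trans (add_le_add h1 h2)
  have hsurj := hG.surjOn_closedBall_of_nonlinearRightInverse g hr0.le subset_rfl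
  have htarget : ((fun _ => ℓ, fun _ => ℓ) : (Fin 3 → ℝ) × (Fin 3 → ℝ)) ∈
      Metric.closedBall (G regularVertex)
        (((g.nnnorm : ℝ)⁻¹ - ((c / 3 + δ.toNNReal : NNReal) : ℝ)) * r) := by
    have hR : 2 * δ ≤ ((g.nnnorm : ℝ)⁻¹ - ((c / 3 + δ.toNNReal : NNReal) : ℝ)) * r := by
      have e1 : ((g.nnnorm : ℝ)⁻¹) = c := by rw [hc]; push_cast; rfl
      have e2 : ((c / 3 + δ.toNNReal : NNReal) : ℝ) = c / 3 + δ := by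
        rw [NNReal.coe_add, Real.coe_toNNReal δ hδ0, NNReal.coe_div]
        rfl
      rw [e1, e2]
      have h1 : δ ≤ c / 3 := min_le_left _ _
      have h2 : δ ≤ c / 6 * r := min_le_right _ _
      nlinarith
    have hcenter := Metric.mem_closedBall_self (x := regularVertex) hr0.le
    rw [mem_closedBall_iff_norm]
    refine le_trans ?_ hR
    have key : ∀ t : ℝ, ‖t‖ ≤ δ → ‖ℓ - (1 + t)‖ ≤ 2 * δ := fun t ht => by
      rw [← sub_sub]
      exact (norm_sub_le _ _).trans (by rw [Real.norm_eq_abs]; linarith)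
    have hGv : G regularVertex = (fun _ => 1, fun _ => 1) + (fun i => η (0, regularVertex i),
        fun i => η (regularVertex i, regularVertex (i + 1))) := by
      simp only [G, edgesSq_regularVertex]
    rw [hGv]
    refine max_le ((pi_norm_le_iff_of_nonneg (by positivity)).2 fun i => ?_)
      ((pi_norm_le_iff_of_nonneg (by positivity)).2 fun i => ?_)
    · exact key _ (hΘ.bound _ (hdom _ hcenter i).1)
    · exact key _ (hΘ.bound _ (hdom _ hcenter i).2)
  obtain ⟨X, hX, hGX⟩ := hsurj htarget
  obtain ⟨-, hXLI, hXn⟩ := hr hX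
  have h0 : ∀ i, Θ 0 (X i) = ℓ := fun i => by
    have := congrFun (congrArg Prod.fst hGX) i
    simpa [G, edgesSq, hη] using this
  have h1 : ∀ i, Θ (X i) (X (i + 1)) = ℓ := fun i => by
    have := congrFun (congrArg Prod.snd hGX) i
    simpa [G, edgesSq, hη] using this
  have hz : ‖(0 : EuclideanSpace ℝ (Fin 3))‖ < 6 / 5 := by simp
  refine ⟨Fin.cons 0 X, rfl, Fin.cases (by simp) (by simpa using hXn),
    affineIndependent_cons_zero hXLI, ?_⟩
  refine Fin.cases (Fin.cases (fun h => absurd rfl h) fun j _ => ?_)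
    fun i => Fin.cases (fun _ => ?_) fun j hij => ?_
  · simpa using h0 j
  · exact (hsymm (X i) 0 (hXn i) hz).trans (h0 i)
  · simp only [Fin.cons_succ]
    -- Modulo 3 distinct indices are neighbours, so the cyclic edges and the symmetry of Θ account
    -- for every pair.
    have hcase : ∀ i j : Fin 3, i ≠ j → j = i + 1 ∨ i = j + 1 := by decide
    rcases hcase i j (fun h => hij (h ▸ rfl)) with rfl | rfl
    · exact h1 i
    · rw [hsymm _ _ (hXn _) (hXn _)]
      exact h1 j
end

/-! ### Reduction of a static spacetime to a rescaled slice -/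

noncomputable section

/-- The restriction of bilinear forms to the space directions. -/
def restrictSpace : BilForm →L[ℝ]
    (EuclideanSpace ℝ (Fin 3) →L[ℝ] EuclideanSpace ℝ (Fin 3) →L[ℝ] ℝ) :=
  (ContinuousLinearMap.postcomp (EuclideanSpace ℝ (Fin 3))
    (ContinuousLinearMap.precomp ℝ
      (ContinuousLinearMap.inr ℝ ℝ (EuclideanSpace ℝ (Fin 3))))).comp
  (ContinuousLinearMap.precomp (Event →L[ℝ] ℝ)
    (ContinuousLinearMap.inr ℝ ℝ (EuclideanSpace ℝ (Fin 3))))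

theorem restrictSpace_apply (B : BilForm) (u v : EuclideanSpace ℝ (Fin 3)) :
    restrictSpace B u v = B (0, u) (0, v) := rfl

theorem norm_zero_prod (u : EuclideanSpace ℝ (Fin 3)) : ‖((0, u) : Event)‖ = ‖u‖ := by
  simp [Prod.norm_def]

theorem norm_timeDir : ‖timeDir‖ = 1 := by
  simp [timeDir, Prod.norm_def]

theorem norm_restrictSpace_le (B : BilForm) : ‖restrictSpace B‖ ≤ ‖B‖ := by
  refine ContinuousLinearMap.opNorm_le_bound₂ _ (norm_nonneg _) fun u v => ?_
  rw [restrictSpace_apply]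
  simpa only [norm_zero_prod] using B.le_opNorm₂ (0, u) (0, v)

theorem restrictSpace_minkowski :
    restrictSpace minkowski = innerForm (EuclideanSpace ℝ (Fin 3)) := by
  ext u v
  simp [restrictSpace_apply, minkowski_apply, innerForm_apply]

/-- The value on `∂/∂t` of the quadratic form of a bilinear form. -/
def evalTime : BilForm →L[ℝ] ℝ :=
  (ContinuousLinearMap.apply ℝ ℝ timeDir).comp
    (ContinuousLinearMap.apply ℝ (Event →L[ℝ] ℝ) timeDir)

theorem evalTime_apply (B : BilForm) : evalTime B = B timeDir timeDir := rfl

theorem norm_evalTime_le (B : BilForm) : ‖evalTime B‖ ≤ ‖B‖ := by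
  rw [evalTime_apply]
  simpa [norm_timeDir] using B.le_opNorm₂ timeDir timeDir

theorem evalTime_minkowski : evalTime minkowski = -1 := by
  simp [evalTime_apply, minkowski_apply, timeDir]

/-- Stated for any form without mixed terms, as it serves both the metric and its space derivatives.
-/
theorem bilForm_apply_of_orthogonal {B : BilForm} (h1 : ∀ v, B timeDir (0, v) = 0)
    (h2 : ∀ v, B (0, v) timeDir = 0) (u w : Event) :
    B u w = evalTime B * (u.1 * w.1) + restrictSpace B u.2 w.2 := by
  have e : ∀ u : Event, u = u.1 • timeDir + (0, u.2) := fun u => by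
    ext <;> simp [timeDir]
  conv_lhs => rw [e u, e w]
  simp only [map_add, map_smul, add_apply, smul_apply, h1, h2, smul_eq_mul, restrictSpace_apply,
    evalTime_apply]
  ring

namespace Spacetime

variable (S : Spacetime) (x₀ : EuclideanSpace ℝ (Fin 3)) (R : ℝ)

/-- The metric on the slice `t = 0`, in the rescaled coordinates `x = x₀ + R ξ`. -/
def sliceMetric (ξ : EuclideanSpace ℝ (Fin 3)) : BilForm := S.metric (0, x₀ + R • ξ)

/-- The squared lapse in rescaled coordinates. -/
def lapseSq (ξ : EuclideanSpace ℝ (Fin 3)) : ℝ := -evalTime (S.sliceMetric x₀ R ξ)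

/-- The spatial metric in rescaled coordinates. -/
def spaceMetric (ξ : EuclideanSpace ℝ (Fin 3)) :
    EuclideanSpace ℝ (Fin 3) →L[ℝ] EuclideanSpace ℝ (Fin 3) →L[ℝ] ℝ :=
  restrictSpace (S.sliceMetric x₀ R ξ)

variable {S x₀ R}

theorem mem_worldTube (hR : 0 < R) {ξ : EuclideanSpace ℝ (Fin 3)}
    (hξ : ξ ∈ Metric.ball (0 : EuclideanSpace ℝ (Fin 3)) 2) (t : ℝ) :
    (t, x₀ + R • ξ) ∈ worldTube x₀ (2 * R) := by
  rw [mem_ball_zero_iff] at hξ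
  change x₀ + R • ξ ∈ Metric.ball x₀ (2 * R)
  rw [mem_ball_iff_norm, add_sub_cancel_left, norm_smul, Real.norm_of_nonneg hR.le]
  nlinarith

theorem rescale_mem (hR : 0 < R) {p : Event} (hp : p ∈ worldTube x₀ (2 * R)) :
    R⁻¹ • (p.2 - x₀) ∈ Metric.ball (0 : EuclideanSpace ℝ (Fin 3)) 2 := by
  have h : p.2 ∈ Metric.ball x₀ (2 * R) := hp
  rw [mem_ball_iff_norm] at h
  rw [mem_ball_zero_iff, norm_smul, norm_inv, Real.norm_of_nonneg hR.le, inv_mul_lt_iff₀ hR]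
  linarith

theorem add_smul_rescale (hR : 0 < R) (x : EuclideanSpace ℝ (Fin 3)) :
    x₀ + R • R⁻¹ • (x - x₀) = x := by
  rw [smul_inv_smul₀ hR.ne', add_sub_cancel]

theorem isOpen_worldTube (r : ℝ) : IsOpen (worldTube x₀ r) :=
  Metric.isOpen_ball.preimage continuous_snd

theorem convex_worldTube (r : ℝ) : Convex ℝ (worldTube x₀ r) :=
  (convex_ball x₀ r).is_linear_preimage (f := Prod.snd) ⟨fun _ _ => rfl, fun _ _ => rfl⟩

theorem contDiffAt_metric {p : Event} (hp : p ∈ S.carrier) : ContDiffAt ℝ ∞ S.metric p :=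
  S.smooth.contDiffAt (S.isOpen_carrier.mem_nhds hp)

section Gentle

variable {ε : ℝ} (hR : 0 < R) (hV : S.IsGentlyCurved (worldTube x₀ (2 * R)) R ε)
include hR hV

theorem mem_carrier {ξ : EuclideanSpace ℝ (Fin 3)}
    (hξ : ξ ∈ Metric.ball (0 : EuclideanSpace ℝ (Fin 3)) 2) (t : ℝ) :
    (t, x₀ + R • ξ) ∈ S.carrier := hV.1 (mem_worldTube hR hξ t)

theorem hasFDerivAt_sliceMetric {ξ : EuclideanSpace ℝ (Fin 3)}
    (hξ : ξ ∈ Metric.ball (0 : EuclideanSpace ℝ (Fin 3)) 2) :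
    HasFDerivAt (S.sliceMetric x₀ R)
      ((fderiv ℝ S.metric (0, x₀ + R • ξ)).comp
        (R • ContinuousLinearMap.inr ℝ ℝ (EuclideanSpace ℝ (Fin 3)))) ξ := by
  have h1 : HasFDerivAt (fun ξ : EuclideanSpace ℝ (Fin 3) => ((0, x₀ + R • ξ) : Event))
      (R • ContinuousLinearMap.inr ℝ ℝ (EuclideanSpace ℝ (Fin 3))) ξ := by
    have h2 := ((R • ContinuousLinearMap.inr ℝ ℝ (EuclideanSpace ℝ (Fin 3))).hasFDerivAt
      (x := ξ)).const_add ((0, x₀) : Event)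
    exact h2.congr_of_eventuallyEq (Filter.Eventually.of_forall fun ξ => by simp)
  exact HasFDerivAt.comp ξ ((contDiffAt_metric (mem_carrier hR hV hξ 0)).differentiableAt
    (by simp)).hasFDerivAt h1

theorem norm_sliceMetric_sub_le {ξ : EuclideanSpace ℝ (Fin 3)}
    (hξ : ξ ∈ Metric.ball (0 : EuclideanSpace ℝ (Fin 3)) 2) :
    ‖S.sliceMetric x₀ R ξ - minkowski‖ ≤ ε := by
  simpa [sliceMetric] using hV.2 _ (mem_worldTube hR hξ 0) 0 (by norm_num)

/-- The tube is convex, so the bound on second derivatives makes the first ones Lipschitz. Rescaling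
brings a factor R for each derivative, cancelling the denominators R and R². -/
theorem boundedLipschitz_fderiv_sliceMetric :
    BoundedLipschitz (Metric.ball (0 : EuclideanSpace ℝ (Fin 3)) 2) ε
      (fderiv ℝ (S.sliceMetric x₀ R)) := by
  have hA : ‖R • ContinuousLinearMap.inr ℝ ℝ (EuclideanSpace ℝ (Fin 3))‖ ≤ R := by
    rw [norm_smul, Real.norm_of_nonneg hR.le]
    exact mul_le_of_le_one_right hR.le (ContinuousLinearMap.norm_inr_le_one ..)
  have hfd : fderiv ℝ (fun q => S.metric q - minkowski) = fderiv ℝ S.metric := by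
    ext1 p
    exact fderiv_sub_const _
  have h1 : ∀ p ∈ worldTube x₀ (2 * R), ‖fderiv ℝ S.metric p‖ ≤ ε / R := fun p hp => by
    have := hV.2 p hp 1 (by norm_num)
    rwa [← norm_iteratedFDeriv_fderiv, norm_iteratedFDeriv_zero, hfd, pow_one] at this
  have h2 : ∀ p ∈ worldTube x₀ (2 * R), ‖fderiv ℝ (fderiv ℝ S.metric) p‖ ≤ ε / R ^ 2 :=
    fun p hp => by
      have := hV.2 p hp 2 le_rfl
      rwa [← norm_iteratedFDeriv_fderiv, hfd, ← norm_iteratedFDeriv_fderiv,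
        norm_iteratedFDeriv_zero] at this
  have h3 : ∀ p ∈ worldTube x₀ (2 * R),
      HasFDerivWithinAt (fderiv ℝ S.metric) (fderiv ℝ (fderiv ℝ S.metric) p)
        (worldTube x₀ (2 * R)) p := fun p hp =>
    (((contDiffAt_metric (hV.1 hp)).fderiv_right (m := 1)
      (WithTop.coe_le_coe.2 le_top)).differentiableAt (by simp)).hasFDerivAt.hasFDerivWithinAt
  refine ⟨fun ξ hξ => ?_, fun ξ hξ ξ' hξ' => ?_⟩
  · rw [(hasFDerivAt_sliceMetric hR hV hξ).fderiv]
    calc _ ≤ ε / R * R := (ContinuousLinearMap.opNorm_comp_le _ _).trans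
          (mul_le_mul (h1 _ (mem_worldTube hR hξ 0)) hA (norm_nonneg _)
            ((norm_nonneg _).trans (h1 _ (mem_worldTube hR hξ 0))))
      _ = ε := by field_simp
  · rw [(hasFDerivAt_sliceMetric hR hV hξ).fderiv, (hasFDerivAt_sliceMetric hR hV hξ').fderiv,
      ← ContinuousLinearMap.sub_comp]
    have h4 := (convex_worldTube (x₀ := x₀) (2 * R)).norm_image_sub_le_of_norm_hasFDerivWithin_le
      h3 h2 (mem_worldTube hR hξ' 0) (mem_worldTube hR hξ 0)
    have h5 : ‖((0, x₀ + R • ξ) : Event) - (0, x₀ + R • ξ')‖ = R * dist ξ ξ' := by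
      rw [Prod.mk_sub_mk, sub_zero, norm_zero_prod, add_sub_add_left_eq_sub, ← smul_sub, norm_smul,
        Real.norm_of_nonneg hR.le, dist_eq_norm]
    rw [h5] at h4
    calc _ ≤ (ε / R ^ 2 * (R * dist ξ ξ')) * R := (ContinuousLinearMap.opNorm_comp_le _ _).trans
          (mul_le_mul h4 hA (norm_nonneg _) ((norm_nonneg _).trans h4))
      _ = ε * dist ξ ξ' := by field_simp

theorem hasFDerivAt_lapseSq {ξ : EuclideanSpace ℝ (Fin 3)}
    (hξ : ξ ∈ Metric.ball (0 : EuclideanSpace ℝ (Fin 3)) 2) :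
    HasFDerivAt (S.lapseSq x₀ R) (-(evalTime.comp (fderiv ℝ (S.sliceMetric x₀ R) ξ))) ξ :=
  (evalTime.hasFDerivAt.comp ξ
    (hasFDerivAt_sliceMetric hR hV hξ).differentiableAt.hasFDerivAt).neg

theorem hasFDerivAt_spaceMetric {ξ : EuclideanSpace ℝ (Fin 3)}
    (hξ : ξ ∈ Metric.ball (0 : EuclideanSpace ℝ (Fin 3)) 2) :
    HasFDerivAt (S.spaceMetric x₀ R) (restrictSpace.comp (fderiv ℝ (S.sliceMetric x₀ R) ξ)) ξ :=
  restrictSpace.hasFDerivAt.comp ξ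
    (hasFDerivAt_sliceMetric hR hV hξ).differentiableAt.hasFDerivAt

/-- Evaluation on ∂/∂t and restriction to space directions do not increase norms, so ε is inherited
unchanged. -/
theorem nearlyFlat : NearlyFlat (S.lapseSq x₀ R) (S.spaceMetric x₀ R) ε := by
  have hBL := boundedLipschitz_fderiv_sliceMetric hR hV
  have e1 : ∀ B : EuclideanSpace ℝ (Fin 3) →L[ℝ] BilForm, ‖-(evalTime.comp B)‖ ≤ ‖B‖ :=
    fun B => by
      rw [norm_neg]
      exact ContinuousLinearMap.opNorm_le_bound _ (norm_nonneg _) fun w =>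
        (norm_evalTime_le _).trans (B.le_opNorm w)
  have e2 : ∀ B : EuclideanSpace ℝ (Fin 3) →L[ℝ] BilForm, ‖restrictSpace.comp B‖ ≤ ‖B‖ :=
    fun B => ContinuousLinearMap.opNorm_le_bound _ (norm_nonneg _) fun w =>
        (norm_restrictSpace_le _).trans (B.le_opNorm w)
  refine ⟨fun ξ hξ => (hasFDerivAt_lapseSq hR hV hξ).differentiableAt,
    fun ξ hξ => (hasFDerivAt_spaceMetric hR hV hξ).differentiableAt,
    fun ξ hξ u v => S.symm _ (mem_carrier hR hV hξ 0) _ _, fun ξ hξ => ?_, fun ξ hξ => ?_,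
    ⟨fun ξ hξ => ?_, fun ξ hξ ξ' hξ' => ?_⟩, ⟨fun ξ hξ => ?_, fun ξ hξ ξ' hξ' => ?_⟩⟩
  · have h1 : S.lapseSq x₀ R ξ - 1 = -evalTime (S.sliceMetric x₀ R ξ - minkowski) := by
      rw [map_sub, evalTime_minkowski, lapseSq]; ring
    rw [h1, norm_neg]
    exact (norm_evalTime_le _).trans (norm_sliceMetric_sub_le hR hV hξ)
  · rw [← restrictSpace_minkowski, spaceMetric, ← map_sub]
    exact (norm_restrictSpace_le _).trans (norm_sliceMetric_sub_le hR hV hξ)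
  · rw [(hasFDerivAt_lapseSq hR hV hξ).fderiv]
    exact (e1 _).trans (hBL.bound ξ hξ)
  · rw [(hasFDerivAt_lapseSq hR hV hξ).fderiv, (hasFDerivAt_lapseSq hR hV hξ').fderiv, neg_sub_neg,
      ← neg_sub, ← ContinuousLinearMap.comp_sub]
    exact (e1 _).trans (hBL.lip ξ hξ ξ' hξ')
  · rw [(hasFDerivAt_spaceMetric hR hV hξ).fderiv]
    exact (e2 _).trans (hBL.bound ξ hξ)
  · rw [(hasFDerivAt_spaceMetric hR hV hξ).fderiv, (hasFDerivAt_spaceMetric hR hV hξ').fderiv,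
      ← ContinuousLinearMap.comp_sub]
    exact (e2 _).trans (hBL.lip ξ hξ ξ' hξ')

/-- Used for the mixed time-space components: they vanish on the whole ball, hence so do their
derivatives. -/
theorem fderiv_sliceMetric_apply_eq_zero {ξ : EuclideanSpace ℝ (Fin 3)}
    (hξ : ξ ∈ Metric.ball (0 : EuclideanSpace ℝ (Fin 3)) 2) {u w : Event}
    (h0 : ∀ ξ ∈ Metric.ball (0 : EuclideanSpace ℝ (Fin 3)) 2, S.sliceMetric x₀ R ξ u w = 0)
    (z : EuclideanSpace ℝ (Fin 3)) : fderiv ℝ (S.sliceMetric x₀ R) ξ z u w = 0 := by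
  obtain ⟨L, hL⟩ : ∃ L : BilForm →L[ℝ] ℝ, ∀ B, L B = B u w :=
    ⟨(ContinuousLinearMap.apply ℝ ℝ w).comp (ContinuousLinearMap.apply ℝ (Event →L[ℝ] ℝ) u),
      fun _ => rfl⟩
  have h1 : HasFDerivAt (fun ξ => L (S.sliceMetric x₀ R ξ))
      (L.comp (fderiv ℝ (S.sliceMetric x₀ R) ξ)) ξ :=
    L.hasFDerivAt.comp ξ (hasFDerivAt_sliceMetric hR hV hξ).differentiableAt.hasFDerivAt
  have h2 : HasFDerivAt (fun ξ => L (S.sliceMetric x₀ R ξ)) 0 ξ :=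
    (hasFDerivAt_const (𝕜 := ℝ) (0 : ℝ) ξ).congr_of_eventuallyEq
      (Filter.eventually_of_mem (Metric.isOpen_ball.mem_nhds hξ)
        fun ξ hξ => (hL _).trans (h0 ξ hξ))
  rw [← hL]
  exact DFunLike.congr_fun (h1.unique h2) z

variable (hS : S.IsStatic)
include hS

theorem metric_eq_sliceMetric {ξ : EuclideanSpace ℝ (Fin 3)}
    (hξ : ξ ∈ Metric.ball (0 : EuclideanSpace ℝ (Fin 3)) 2) (t : ℝ) :
    S.metric (t, x₀ + R • ξ) = S.sliceMetric x₀ R ξ :=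
  hS.metric_translate _ _ _ (mem_carrier hR hV hξ t)

theorem sliceMetric_time_space {ξ : EuclideanSpace ℝ (Fin 3)}
    (hξ : ξ ∈ Metric.ball (0 : EuclideanSpace ℝ (Fin 3)) 2) (v : EuclideanSpace ℝ (Fin 3)) :
    S.sliceMetric x₀ R ξ timeDir (0, v) = 0 :=
  hS.orthogonal _ (mem_carrier hR hV hξ 0) v

theorem sliceMetric_space_time {ξ : EuclideanSpace ℝ (Fin 3)}
    (hξ : ξ ∈ Metric.ball (0 : EuclideanSpace ℝ (Fin 3)) 2) (v : EuclideanSpace ℝ (Fin 3)) :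
    S.sliceMetric x₀ R ξ (0, v) timeDir = 0 :=
  (S.symm _ (mem_carrier hR hV hξ 0) _ _).trans (sliceMetric_time_space hR hV hS hξ v)

theorem metric_apply {ξ : EuclideanSpace ℝ (Fin 3)}
    (hξ : ξ ∈ Metric.ball (0 : EuclideanSpace ℝ (Fin 3)) 2) (t : ℝ) (u w : Event) :
    S.metric (t, x₀ + R • ξ) u w =
      -S.lapseSq x₀ R ξ * (u.1 * w.1) + S.spaceMetric x₀ R ξ u.2 w.2 := by
  rw [metric_eq_sliceMetric hR hV hS hξ, bilForm_apply_of_orthogonal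
    (sliceMetric_time_space hR hV hS hξ) (sliceMetric_space_time hR hV hS hξ), lapseSq, neg_neg,
    spaceMetric]

/-- Near the event the metric is the slice metric composed with p ↦ (p.2 − x₀)/R. This accounts for
R⁻¹ and for the absence of the time component of z. -/
theorem fderiv_metric_apply {ξ : EuclideanSpace ℝ (Fin 3)}
    (hξ : ξ ∈ Metric.ball (0 : EuclideanSpace ℝ (Fin 3)) 2) (t : ℝ) (z u w : Event) :
    fderiv ℝ S.metric (t, x₀ + R • ξ) z u w =
      R⁻¹ * (-fderiv ℝ (S.lapseSq x₀ R) ξ z.2 * (u.1 * w.1)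
        + fderiv ℝ (S.spaceMetric x₀ R) ξ z.2 u.2 w.2) := by
  have h1 : S.metric =ᶠ[nhds (t, x₀ + R • ξ)]
      fun p => S.sliceMetric x₀ R (R⁻¹ • (p.2 - x₀)) := by
    refine Filter.eventually_of_mem ((isOpen_worldTube _).mem_nhds (mem_worldTube hR hξ t))
      fun p hp => ?_
    have := metric_eq_sliceMetric hR hV hS (rescale_mem hR hp) p.1
    rwa [add_smul_rescale hR] at this
  have h2 : HasFDerivAt (fun p : Event => R⁻¹ • (p.2 - x₀))
      (R⁻¹ • ContinuousLinearMap.snd ℝ ℝ (EuclideanSpace ℝ (Fin 3))) (t, x₀ + R • ξ) :=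
    (hasFDerivAt_snd.sub_const x₀).const_smul R⁻¹
  have hξ' : R⁻¹ • (((t, x₀ + R • ξ) : Event).2 - x₀) = ξ := by
    simp [smul_smul, hR.ne']
  have h3 : HasFDerivAt (S.sliceMetric x₀ R) (fderiv ℝ (S.sliceMetric x₀ R) ξ)
      (R⁻¹ • (((t, x₀ + R • ξ) : Event).2 - x₀)) := by
    rw [hξ']
    exact (hasFDerivAt_sliceMetric hR hV hξ).differentiableAt.hasFDerivAt
  have h4 := (h3.comp (t, x₀ + R • ξ) h2).congr_of_eventuallyEq h1
  have h5 : fderiv ℝ S.metric (t, x₀ + R • ξ) z = R⁻¹ • fderiv ℝ (S.sliceMetric x₀ R) ξ z.2 := by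
    rw [h4.fderiv]
    simp
  have h6 := bilForm_apply_of_orthogonal (B := fderiv ℝ (S.sliceMetric x₀ R) ξ z.2)
    (fun v => fderiv_sliceMetric_apply_eq_zero hR hV hξ
      (fun ξ hξ => sliceMetric_time_space hR hV hS hξ v) z.2)
    (fun v => fderiv_sliceMetric_apply_eq_zero hR hV hξ
      (fun ξ hξ => sliceMetric_space_time hR hV hS hξ v) z.2) u w
  rw [h5, smul_apply, smul_apply, h6, smul_eq_mul, (hasFDerivAt_lapseSq hR hV hξ).fderiv,
    (hasFDerivAt_spaceMetric hR hV hξ).fderiv]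
  simp

end Gentle

end Spacetime
end

/-! ### Correspondence between null geodesics and rays -/

noncomputable section

theorem contDiffOn_two_of_hasDerivWithinAt {F : Type*} [NormedAddCommGroup F] [NormedSpace ℝ F]
    {c c' c'' : ℝ → F} (h1 : ∀ s ∈ Icc (0 : ℝ) 1, HasDerivWithinAt c (c' s) (Icc 0 1) s)
    (h2 : ∀ s ∈ Icc (0 : ℝ) 1, HasDerivWithinAt c' (c'' s) (Icc 0 1) s)
    (h3 : ContinuousOn c'' (Icc 0 1)) :
    ContDiffOn ℝ 2 c (Icc 0 1) ∧ ∀ s ∈ Icc (0 : ℝ) 1, derivWithin c (Icc 0 1) s = c' s ∧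
      derivWithin (derivWithin c (Icc 0 1)) (Icc 0 1) s = c'' s := by
  have hu : UniqueDiffOn ℝ (Icc (0 : ℝ) 1) := uniqueDiffOn_Icc zero_lt_one
  have e1 : ∀ s ∈ Icc (0 : ℝ) 1, derivWithin c (Icc 0 1) s = c' s := fun s hs =>
    (h1 s hs).derivWithin (hu s hs)
  have h2' : ∀ s ∈ Icc (0 : ℝ) 1,
      HasDerivWithinAt (derivWithin c (Icc 0 1)) (c'' s) (Icc 0 1) s := fun s hs =>
    (h2 s hs).congr e1 (e1 s hs)
  have e2 : ∀ s ∈ Icc (0 : ℝ) 1,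
      derivWithin (derivWithin c (Icc 0 1)) (Icc 0 1) s = c'' s := fun s hs =>
    (h2' s hs).derivWithin (hu s hs)
  refine ⟨?_, fun s hs => ⟨e1 s hs, e2 s hs⟩⟩
  rw [show (2 : WithTop ℕ∞) = 1 + 1 from one_add_one_eq_two.symm,
    contDiffOn_succ_iff_derivWithin hu]
  refine ⟨fun s hs => (h1 s hs).differentiableWithinAt, by simp, ?_⟩
  rw [show (1 : WithTop ℕ∞) = 0 + 1 from (zero_add 1).symm, contDiffOn_succ_iff_derivWithin hu]
  exact ⟨fun s hs => (h2' s hs).differentiableWithinAt, by simp, contDiffOn_zero.2 (h3.congr e2)⟩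

theorem hasDerivWithinAt_of_contDiffOn_two {F : Type*} [NormedAddCommGroup F] [NormedSpace ℝ F]
    {c : ℝ → F} (hc : ContDiffOn ℝ 2 c (Icc 0 1)) :
    (∀ s ∈ Icc (0 : ℝ) 1, HasDerivWithinAt c (derivWithin c (Icc 0 1) s) (Icc 0 1) s) ∧
    (∀ s ∈ Icc (0 : ℝ) 1, HasDerivWithinAt (derivWithin c (Icc 0 1))
      (derivWithin (derivWithin c (Icc 0 1)) (Icc 0 1) s) (Icc 0 1) s) ∧
    ContinuousOn (derivWithin (derivWithin c (Icc 0 1)) (Icc 0 1)) (Icc 0 1) := by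
  have hu : UniqueDiffOn ℝ (Icc (0 : ℝ) 1) := uniqueDiffOn_Icc zero_lt_one
  rw [show (2 : WithTop ℕ∞) = 1 + 1 from one_add_one_eq_two.symm,
    contDiffOn_succ_iff_derivWithin hu] at hc
  obtain ⟨h1, -, h2⟩ := hc
  rw [show (1 : WithTop ℕ∞) = 0 + 1 from (zero_add 1).symm,
    contDiffOn_succ_iff_derivWithin hu] at h2
  obtain ⟨h3, -, h4⟩ := h2
  exact ⟨fun s hs => (h1 s hs).hasDerivWithinAt, fun s hs => (h3 s hs).hasDerivWithinAt,
    h4.continuousOn⟩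

theorem HasDerivWithinAt.event_fst {c : ℝ → Event} {c' : Event} {I : Set ℝ} {s : ℝ}
    (hc : HasDerivWithinAt c c' I s) : HasDerivWithinAt (fun s => (c s).1) c'.1 I s :=
  (ContinuousLinearMap.fst ℝ ℝ (EuclideanSpace ℝ (Fin 3))).hasFDerivAt.comp_hasDerivWithinAt s hc

theorem HasDerivWithinAt.event_snd {c : ℝ → Event} {c' : Event} {I : Set ℝ} {s : ℝ}
    (hc : HasDerivWithinAt c c' I s) : HasDerivWithinAt (fun s => (c s).2) c'.2 I s :=
  (ContinuousLinearMap.snd ℝ ℝ (EuclideanSpace ℝ (Fin 3))).hasFDerivAt.comp_hasDerivWithinAt s hc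

namespace Spacetime

variable {S : Spacetime} {x₀ : EuclideanSpace ℝ (Fin 3)} {R ε : ℝ} (hR : 0 < R)
  (hV : S.IsGentlyCurved (worldTube x₀ (2 * R)) R ε) (hS : S.IsStatic)
include hR hV hS

/-- Null geodesics project to rays; the time coordinate is governed by the conserved energy. -/
theorem IsNullGeodesic.exists_isRay {c : ℝ → Event} {p p' : Event}
    (hc : S.IsNullGeodesic (worldTube x₀ (2 * R)) c p p') :
    ∃ (v q : ℝ → EuclideanSpace ℝ (Fin 3)) (P : ℝ), 0 < P ∧
      IsRay (S.lapseSq x₀ R) (S.spaceMetric x₀ R) (fun s => R⁻¹ • ((c s).2 - x₀)) v q ∧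
      (∀ s ∈ Icc (0 : ℝ) 1, HasDerivWithinAt (fun s => (c s).1)
        (P * (S.lapseSq x₀ R (R⁻¹ • ((c s).2 - x₀)))⁻¹) (Icc 0 1) s) ∧
      P ^ 2 = R ^ 2 * (S.lapseSq x₀ R (R⁻¹ • ((c 0).2 - x₀)) *
        S.spaceMetric x₀ R (R⁻¹ • ((c 0).2 - x₀)) (v 0) (v 0)) := by
  obtain ⟨hd1, hd2, hd3⟩ := hasDerivWithinAt_of_contDiffOn_two hc.smooth
  set c' := derivWithin c (Icc 0 1) with hc'
  set c'' := derivWithin c' (Icc 0 1) with hc''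
  set ξ : ℝ → EuclideanSpace ℝ (Fin 3) := fun s => R⁻¹ • ((c s).2 - x₀) with hξdef
  set f := S.lapseSq x₀ R with hf
  set h := S.spaceMetric x₀ R with hh
  have hR0 : R ≠ 0 := hR.ne'
  have hξ : ∀ s ∈ Icc (0 : ℝ) 1, ξ s ∈ Metric.ball (0 : EuclideanSpace ℝ (Fin 3)) 2 :=
    fun s hs => rescale_mem hR (hc.mem s hs)
  have hcξ : ∀ s, c s = ((c s).1, x₀ + R • ξ s) := fun s => by
    rw [hξdef, add_smul_rescale hR]
  set v : ℝ → EuclideanSpace ℝ (Fin 3) := fun s => R⁻¹ • (c' s).2 with hv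
  set a : ℝ → EuclideanSpace ℝ (Fin 3) := fun s => R⁻¹ • (c'' s).2 with ha
  have hv' : ∀ s, (c' s).2 = R • v s := fun s => (smul_inv_smul₀ hR0 _).symm
  have ha' : ∀ s, (c'' s).2 = R • a s := fun s => (smul_inv_smul₀ hR0 _).symm
  have hξd : ∀ s ∈ Icc (0 : ℝ) 1, HasDerivWithinAt ξ (v s) (Icc 0 1) s := fun s hs =>
    ((hd1 s hs).event_snd.sub_const x₀).const_smul R⁻¹
  have hvd : ∀ s ∈ Icc (0 : ℝ) 1, HasDerivWithinAt v (a s) (Icc 0 1) s := fun s hs =>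
    (hd2 s hs).event_snd.const_smul R⁻¹
  have htd : ∀ s ∈ Icc (0 : ℝ) 1, HasDerivWithinAt (fun s => (c s).1) (c' s).1 (Icc 0 1) s :=
    fun s hs => (hd1 s hs).event_fst
  have htd2 : ∀ s ∈ Icc (0 : ℝ) 1, HasDerivWithinAt (fun s => (c' s).1) (c'' s).1 (Icc 0 1) s :=
    fun s hs => (hd2 s hs).event_fst
  have hgeo : ∀ s ∈ Icc (0 : ℝ) 1, ∀ w : Event,
      -f (ξ s) * ((c'' s).1 * w.1) + R * h (ξ s) (a s) w.2
      + (-fderiv ℝ f (ξ s) (v s) * ((c' s).1 * w.1) + R * fderiv ℝ h (ξ s) (v s) (v s) w.2)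
      - 1 / 2 * (R⁻¹ * (-fderiv ℝ f (ξ s) w.2 * ((c' s).1 * (c' s).1))
        + R * fderiv ℝ h (ξ s) w.2 (v s) (v s)) = 0 := fun s hs w => by
    have h1 := hc.geodesic s hs w
    rw [hcξ s, metric_apply hR hV hS (hξ s hs), fderiv_metric_apply hR hV hS (hξ s hs),
      fderiv_metric_apply hR hV hS (hξ s hs), hv', ha'] at h1
    simp only [map_smul, smul_apply, smul_eq_mul, ← hf, ← hh, ← hc', ← hc''] at h1
    rw [← h1]
    field_simp
  have hnull : ∀ s ∈ Icc (0 : ℝ) 1,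
      f (ξ s) * ((c' s).1 * (c' s).1) = R ^ 2 * h (ξ s) (v s) (v s) := fun s hs => by
    have h1 := hc.null s hs
    rw [hcξ s, metric_apply hR hV hS (hξ s hs), hv'] at h1
    simp only [map_smul, smul_apply, smul_eq_mul] at h1
    linarith
  have hfut : ∀ s ∈ Icc (0 : ℝ) 1, 0 < f (ξ s) * (c' s).1 := fun s hs => by
    have h1 := hc.future s hs
    rw [hcξ s, metric_apply hR hV hS (hξ s hs)] at h1
    simp only [timeDir, map_zero, zero_apply, one_mul] at h1
    linarith
  have hfd : ∀ s ∈ Icc (0 : ℝ) 1,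
      HasDerivWithinAt (fun s => f (ξ s)) (fderiv ℝ f (ξ s) (v s)) (Icc 0 1) s := fun s hs =>
    ((nearlyFlat hR hV).differentiable_lapse _ (hξ s hs)).hasFDerivAt.comp_hasDerivWithinAt s
      (hξd s hs)
  have hconst : ∀ s ∈ Icc (0 : ℝ) 1, f (ξ s) * (c' s).1 = f (ξ 0) * (c' 0).1 := fun s hs => by
    have h1 : ∀ s ∈ Icc (0 : ℝ) 1,
        HasDerivWithinAt (fun s => f (ξ s) * (c' s).1) 0 (Icc 0 1) s := fun s hs => by
      refine ((hfd s hs).mul (htd2 s hs)).congr_deriv ?_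
      -- The time component of the geodesic equation is −(f·t')' = 0.
      have h2 := hgeo s hs timeDir
      simp only [timeDir, map_zero, zero_apply, mul_one, neg_zero, zero_mul, mul_zero] at h2
      linarith
    have h2 := (convex_Icc (0 : ℝ) 1).norm_image_sub_le_of_norm_hasDerivWithin_le (C := 0)
      h1 (by simp) (left_mem_Icc.2 zero_le_one) hs
    rw [zero_mul, norm_le_zero_iff, sub_eq_zero] at h2
    exact h2
  have hf0 : ∀ s ∈ Icc (0 : ℝ) 1, f (ξ s) ≠ 0 := fun s hs h0 => by
    have := hfut s hs
    rw [h0, zero_mul] at this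
    exact lt_irrefl _ this
  have h00 : (0 : ℝ) ∈ Icc (0 : ℝ) 1 := left_mem_Icc.2 zero_le_one
  refine ⟨v, a, f (ξ 0) * (c' 0).1, hfut 0 h00, ⟨⟨hξd, hvd, ?_⟩, hξ, fun s hs w => ?_⟩,
    fun s hs => ?_, ?_⟩
  · exact (continuous_snd.comp_continuousOn hd3).const_smul R⁻¹
  · rw [inner_add_forceForm]
    have h1 := hgeo s hs (0, w)
    have h2 := hnull s hs
    simp only [mul_zero, zero_add] at h1
    -- The null condition eliminates t' from the space component.
    have h3 : f (ξ s) * (R⁻¹ * (-fderiv ℝ f (ξ s) w * ((c' s).1 * (c' s).1)))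
        = -(R * (h (ξ s) (v s) (v s) * fderiv ℝ f (ξ s) w)) := by
      calc _ = R⁻¹ * -fderiv ℝ f (ξ s) w * (f (ξ s) * ((c' s).1 * (c' s).1)) := by ring
        _ = _ := by rw [h2]; field_simp
    have h4 : R * (f (ξ s) * h (ξ s) (a s) w + f (ξ s) * fderiv ℝ h (ξ s) (v s) (v s) w
        - 1 / 2 * (f (ξ s) * fderiv ℝ h (ξ s) w (v s) (v s))
        + 1 / 2 * (h (ξ s) (v s) (v s) * fderiv ℝ f (ξ s) w)) = 0 := by
      linear_combination f (ξ s) * h1 + 1 / 2 * h3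
    exact (mul_eq_zero.1 h4).resolve_left hR0
  · refine (htd s hs).congr_deriv ?_
    rw [← hconst s hs]
    change (c' s).1 = f (ξ s) * (c' s).1 * (f (ξ s))⁻¹
    have := hf0 s hs
    field_simp
  · have h2 := hnull 0 h00
    change (f (ξ 0) * (c' 0).1) ^ 2 = R ^ 2 * (f (ξ 0) * h (ξ 0) (v 0) (v 0))
    linear_combination f (ξ 0) * h2

/-- A ray with nonzero energy lifts to a null geodesic. -/
theorem isNullGeodesic_of_isRay {y v q : ℝ → EuclideanSpace ℝ (Fin 3)} (hε : ε ≤ 1 / 2)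
    (hy : IsRay (S.lapseSq x₀ R) (S.spaceMetric x₀ R) y v q) {P : ℝ} (hP : 0 < P)
    (hP2 : P ^ 2 = R ^ 2 * (S.lapseSq x₀ R (y 0) * S.spaceMetric x₀ R (y 0) (v 0) (v 0)))
    {t : ℝ → ℝ} (ht : ∀ s ∈ Icc (0 : ℝ) 1,
      HasDerivWithinAt t (P * (S.lapseSq x₀ R (y s))⁻¹) (Icc 0 1) s) :
    S.IsNullGeodesic (worldTube x₀ (2 * R)) (fun s => (t s, x₀ + R • y s))
      (t 0, x₀ + R • y 0) (t 1, x₀ + R • y 1) := by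
  have hflat := nearlyFlat hR hV
  set f := S.lapseSq x₀ R with hf
  set h := S.spaceMetric x₀ R with hh
  have hR0 : R ≠ 0 := hR.ne'
  have hpos : ∀ s ∈ Icc (0 : ℝ) 1, 0 < f (y s) := fun s hs => hflat.lapse_pos hε (hy.mem s hs)
  have hfd : ∀ s ∈ Icc (0 : ℝ) 1,
      HasDerivWithinAt (fun s => f (y s)) (fderiv ℝ f (y s) (v s)) (Icc 0 1) s := fun s hs =>
    (hflat.differentiable_lapse _ (hy.mem s hs)).hasFDerivAt.comp_hasDerivWithinAt s
      (hy.velocity s hs)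
  have hcd : ∀ s ∈ Icc (0 : ℝ) 1, HasDerivWithinAt (fun s => ((t s, x₀ + R • y s) : Event))
      (P * (f (y s))⁻¹, R • v s) (Icc 0 1) s := fun s hs =>
    (ht s hs).prodMk (((hy.velocity s hs).const_smul R).const_add x₀)
  have hcd2 : ∀ s ∈ Icc (0 : ℝ) 1,
      HasDerivWithinAt (fun s => ((P * (f (y s))⁻¹, R • v s) : Event))
      (P * (-fderiv ℝ f (y s) (v s) / f (y s) ^ 2), R • q s) (Icc 0 1) s := fun s hs =>
    (((hfd s hs).fun_inv (hpos s hs).ne').const_mul P).prodMk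
      ((hy.acceleration s hs).const_smul R)
  have hfc : ContinuousOn (fun s => f (y s)) (Icc 0 1) :=
    fun s hs => (hfd s hs).continuousWithinAt
  have hfc' : ContinuousOn (fun s => fderiv ℝ f (y s)) (Icc 0 1) := by
    have h1 : ContinuousOn (fderiv ℝ f) (Metric.ball 0 2) :=
      (LipschitzOnWith.of_dist_le_mul (K := ⟨ε, hflat.eps_nonneg⟩) fun p hp p' hp' => by
        rw [dist_eq_norm]; exact hflat.lapse_deriv.lip p hp p' hp').continuousOn
    exact h1.comp hy.continuousOn_position hy.mem
  have hcont : ContinuousOn (fun s =>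
      ((P * (-fderiv ℝ f (y s) (v s) / f (y s) ^ 2), R • q s) : Event)) (Icc 0 1) :=
    (continuousOn_const.mul (((hfc'.clm_apply hy.continuousOn_velocity).neg).div (hfc.pow 2)
      fun s hs => pow_ne_zero 2 (hpos s hs).ne')).prodMk
      (hy.continuousOn.const_smul R)
  obtain ⟨hsm, hder⟩ := contDiffOn_two_of_hasDerivWithinAt hcd hcd2 hcont
  -- The relation between P and the energy is assumed at s = 0 only; conservation carries it, and
  -- with it the null condition, along the ray.
  have henergy : ∀ s ∈ Icc (0 : ℝ) 1, P ^ 2 = R ^ 2 * (f (y s) * h (y s) (v s) (v s)) :=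
    fun s hs => by rw [hP2, hy.energy_eq hflat hs]
  refine ⟨rfl, rfl, fun s hs => mem_worldTube hR (hy.mem s hs) _, hsm, fun s hs => ?_,
    fun s hs => ?_, fun s hs w => ?_⟩
  · rw [(hder s hs).1, metric_apply hR hV hS (hy.mem s hs)]
    simp only [map_smul, smul_apply, smul_eq_mul, ← hf, ← hh]
    have h1 := henergy s hs
    have h2 := (hpos s hs).ne'
    field_simp
    linear_combination -h1
  · rw [(hder s hs).1, metric_apply hR hV hS (hy.mem s hs)]
    simp only [timeDir, map_zero, zero_apply, one_mul, add_zero]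
    have h2 := hpos s hs
    have h3 : -S.lapseSq x₀ R (y s) * (P * (f (y s))⁻¹) = -P := by
      rw [← hf]; field_simp
    rw [h3]
    linarith
  · rw [(hder s hs).1, (hder s hs).2, metric_apply hR hV hS (hy.mem s hs),
      fderiv_metric_apply hR hV hS (hy.mem s hs), fderiv_metric_apply hR hV hS (hy.mem s hs)]
    simp only [map_smul, smul_apply, smul_eq_mul, ← hf, ← hh]
    have h1 := henergy s hs
    have h2 := (hpos s hs).ne'
    have h3 := hy.equation s hs w.2
    rw [inner_add_forceForm] at h3
    have h5 : (P * (f (y s))⁻¹) * (P * (f (y s))⁻¹)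
        = R ^ 2 * h (y s) (v s) (v s) * (f (y s))⁻¹ := by
      calc _ = P ^ 2 * ((f (y s))⁻¹) ^ 2 := by ring
        _ = _ := by rw [h1]; field_simp
    rw [h5]
    have h6 : f (y s) * h (y s) (q s) w.2 = -(f (y s) * fderiv ℝ h (y s) (v s) (v s) w.2)
        + 1 / 2 * (f (y s) * fderiv ℝ h (y s) w.2 (v s) (v s))
        - 1 / 2 * (h (y s) (v s) (v s) * fderiv ℝ f (y s) w.2) := by linarith
    have h7 : h (y s) (q s) w.2 = -fderiv ℝ h (y s) (v s) (v s) w.2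
        + 1 / 2 * fderiv ℝ h (y s) w.2 (v s) (v s)
        - 1 / 2 * (h (y s) (v s) (v s) * fderiv ℝ f (y s) w.2) * (f (y s))⁻¹ := by
      apply mul_left_cancel₀ h2
      rw [h6]
      field_simp
    rw [h7]
    field_simp
    ring

end Spacetime
end

/-! ### Signals between points at rest -/

noncomputable section

/-- Distinct endpoints force a nonzero velocity somewhere, and the energy is the same everywhere. -/
theorem IsRay.energy_pos {E : Type*} [NormedAddCommGroup E] [InnerProductSpace ℝ E]
    {f : E → ℝ} {h : E → E →L[ℝ] E →L[ℝ] ℝ} {ε : ℝ} (hfh : NearlyFlat f h ε) (hε : ε ≤ 1 / 2)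
    {y v q : ℝ → E} (hy : IsRay f h y v q) (hne : y 0 ≠ y 1) :
    0 < f (y 0) * h (y 0) (v 0) (v 0) := by
  obtain ⟨s, hs, hvs⟩ : ∃ s ∈ Icc (0 : ℝ) 1, v s ≠ 0 := by
    by_contra! hv
    have := hy.norm_position_sub_le (K := 0) (fun s hs => by simp [hv s hs])
      (right_mem_Icc.2 zero_le_one)
    exact hne (sub_eq_zero.1 (norm_le_zero_iff.1 this)).symm
  rw [← hy.energy_eq hfh hs]
  exact mul_pos (hfh.lapse_pos hε (hy.mem s hs)) (hfh.metric_pos hε (hy.mem s hs) hvs)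

namespace Spacetime

variable {S : Spacetime} {x₀ : EuclideanSpace ℝ (Fin 3)} {R ε : ℝ}

section Signals

variable (hR : 0 < R) (hV : S.IsGentlyCurved (worldTube x₀ (2 * R)) R ε) (hS : S.IsStatic)
  (hε : ε ≤ 1 / 1000000)
include hR hV hS hε

theorem IsNullGeodesic.eqOn {c c' : ℝ → Event} {p p' : Event}
    (hc : S.IsNullGeodesic (worldTube x₀ (2 * R)) c p p')
    (hc' : S.IsNullGeodesic (worldTube x₀ (2 * R)) c' p p') : EqOn c c' (Icc 0 1) := by
  obtain ⟨v, q, P, hP, hy, ht, hP2⟩ := hc.exists_isRay hR hV hS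
  obtain ⟨v', q', P', hP', hy', ht', hP2'⟩ := hc'.exists_isRay hR hV hS
  have h00 : (0 : ℝ) ∈ Icc (0 : ℝ) 1 := left_mem_Icc.2 zero_le_one
  have hagree := fun (s : ℝ) hs => hy.eqOn (nearlyFlat hR hV) hε hy'
    (by simp only [hc.source, hc'.source]) (by simp only [hc.target, hc'.target]) (s := s) hs
  -- Both are the positive root of the same expression in the common initial position and velocity.
  have hPP : P = P' := by
    rw [← pow_left_inj₀ hP.le hP'.le two_ne_zero, hP2, hP2', (hagree 0 h00).2,
      hc.source, hc'.source]
  have hspace : ∀ s ∈ Icc (0 : ℝ) 1, (c s).2 = (c' s).2 := fun s hs => by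
    rw [← add_smul_rescale (x₀ := x₀) hR (c s).2, ← add_smul_rescale (x₀ := x₀) hR (c' s).2,
      (hagree s hs).1]
  have hd : ∀ s ∈ Icc (0 : ℝ) 1,
      HasDerivWithinAt (fun s => (c s).1 - (c' s).1) 0 (Icc 0 1) s := fun s hs => by
    refine ((ht s hs).sub (ht' s hs)).congr_deriv ?_
    rw [hPP, (hagree s hs).1, sub_self]
  intro s hs
  have h1 := (convex_Icc (0 : ℝ) 1).norm_image_sub_le_of_norm_hasDerivWithin_le (C := 0)
    hd (by simp) h00 hs
  rw [zero_mul, norm_le_zero_iff, hc.source, hc'.source, sub_self, sub_zero, sub_eq_zero] at h1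
  exact Prod.ext h1 (hspace s hs)

variable {Θ : EuclideanSpace ℝ (Fin 3) → EuclideanSpace ℝ (Fin 3) → ℝ}
  (hΘ : ∀ y v q : ℝ → EuclideanSpace ℝ (Fin 3),
    IsRay (S.lapseSq x₀ R) (S.spaceMetric x₀ R) y v q → ‖y 0‖ < 6 / 5 → ‖y 1‖ < 6 / 5 →
    travelTimeSq (S.lapseSq x₀ R) (S.spaceMetric x₀ R) y v = Θ (y 0) (y 1))
  {a b : EuclideanSpace ℝ (Fin 3)} (ha : ‖a‖ < 6 / 5) (hb : ‖b‖ < 6 / 5)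
include hΘ ha hb

/-- Integrating t' = P/f gives the delay P·∫ 1/f, which is positive and has the square R²·Θ(a, b).
-/
theorem IsNullGeodesic.time_eq {c : ℝ → Event} {t t' : ℝ}
    (hc : S.IsNullGeodesic (worldTube x₀ (2 * R)) c (t, x₀ + R • a) (t', x₀ + R • b)) :
    t' = t + R * √(Θ a b) := by
  obtain ⟨v, q, P, hP, hy, ht, hP2⟩ := hc.exists_isRay hR hV hS
  have hflat := nearlyFlat hR hV
  have hε' : ε ≤ 1 / 2 := by linarith
  have e0 : R⁻¹ • ((c 0).2 - x₀) = a := by simp [hc.source, smul_smul, hR.ne']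
  have e1 : R⁻¹ • ((c 1).2 - x₀) = b := by simp [hc.target, smul_smul, hR.ne']
  have hsq := hΘ _ _ _ hy (by rwa [e0]) (by rwa [e1])
  simp only [e0, e1] at hsq
  have hint := hy.intervalIntegrable_inv_lapse hflat hε'
  have hI := intervalIntegral.integral_eq_sub_of_hasDerivAt_of_le zero_le_one
    (fun s hs => (ht s hs).continuousWithinAt)
    (fun s hs => (ht s (Ioo_subset_Icc_self hs)).hasDerivAt (Icc_mem_nhds hs.1 hs.2))
    (hint.const_mul P)
  rw [intervalIntegral.integral_const_mul, hc.source, hc.target] at hI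
  have hIpos := intervalIntegral.intervalIntegral_pos_of_pos_on hint
    (fun s hs => inv_pos.2 (hflat.lapse_pos hε' (hy.mem s (Ioo_subset_Icc_self hs))))
    zero_lt_one
  set I := ∫ s in (0 : ℝ)..1, (S.lapseSq x₀ R (R⁻¹ • ((c s).2 - x₀)))⁻¹ with hIdef
  have h1 : (P * I) ^ 2 = R ^ 2 * Θ a b := by
    rw [← hsq, travelTimeSq, mul_pow, hP2, hIdef]
    ring
  have h2 : P * I = R * √(Θ a b) := by
    rw [← Real.sqrt_sq (mul_pos hP hIpos).le, h1, Real.sqrt_mul (sq_nonneg R),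
      Real.sqrt_sq hR.le]
  dsimp only at hI
  linarith

theorem exists_isNullGeodesic (hab : a ≠ b) (t : ℝ) :
    ∃ c, S.IsNullGeodesic (worldTube x₀ (2 * R)) c (t, x₀ + R • a)
      (t + R * √(Θ a b), x₀ + R • b) := by
  have hflat := nearlyFlat hR hV
  have hε' : ε ≤ 1 / 2 := by linarith
  obtain ⟨y, v, q, hy, rfl, rfl⟩ := _root_.exists_isRay hflat hε ha hb
  have hpos := hy.energy_pos hflat hε' hab
  set P := R * √(S.lapseSq x₀ R (y 0) * S.spaceMetric x₀ R (y 0) (v 0) (v 0)) with hPdef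
  have hP : 0 < P := mul_pos hR (Real.sqrt_pos.2 hpos)
  -- Extended continuously to the line, so that the primitive is differentiable at 0 and 1 as well.
  let F : ℝ → ℝ := IccExtend zero_le_one
    ((Icc (0 : ℝ) 1).domRestrict fun s => P * (S.lapseSq x₀ R (y s))⁻¹)
  have hF : Continuous F :=
    (continuousOn_iff_continuous_domRestrict.1
      ((hy.continuousOn_inv_lapse hflat hε').const_mul P)).Icc_extend'
  have hF' : ∀ s ∈ Icc (0 : ℝ) 1, F s = P * (S.lapseSq x₀ R (y s))⁻¹ := fun s hs =>
    IccExtend_of_mem zero_le_one _ hs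
  have hgeo := isNullGeodesic_of_isRay hR hV hS hε' hy hP
    (by rw [hPdef, mul_pow, Real.sq_sqrt hpos.le]) (t := fun s => t + ∫ σ in (0 : ℝ)..s, F σ)
    fun s hs => by
      rw [← hF' s hs]
      exact ((hasDerivAt_primitive hF s).const_add t).hasDerivWithinAt
  rw [intervalIntegral.integral_same, add_zero] at hgeo
  -- The arrival time of the lift need not be computed: `time_eq` already determines it.
  rw [← hgeo.time_eq hR hV hS hε hΘ ha hb]
  exact ⟨_, hgeo⟩

end Signals

/-! ### Machines at rest and channels of constant delay -/

/-- The worldline of the machine at rest at `x` whose ticks are separated by the coordinate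
time `T`. -/
def restMachine (T : ℝ) (x : EuclideanSpace ℝ (Fin 3)) (ζ : ℝ) : Event := (T * ζ, x)

theorem hasDerivAt_restMachine (T : ℝ) (x : EuclideanSpace ℝ (Fin 3)) (ζ : ℝ) :
    HasDerivAt (restMachine T x) (T • timeDir) ζ := by
  have h : HasDerivAt (restMachine T x) (T * 1, 0) ζ :=
    ((hasDerivAt_id ζ).const_mul T).prodMk (hasDerivAt_const ζ x)
  exact h.congr_deriv (by simp [timeDir])

theorem isOpenMachine_restMachine {V : Set Event} {T : ℝ} (hT : 0 < T)
    {x : EuclideanSpace ℝ (Fin 3)} (hmem : ∀ t, (t, x) ∈ V) (hV : V ⊆ S.carrier) :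
    S.IsOpenMachine V (restMachine T x) := by
  have hsm : ContDiff ℝ ∞ (restMachine T x) :=
    (contDiff_const.mul contDiff_id).prodMk contDiff_const
  have hg : ∀ ζ, S.metric (restMachine T x ζ) timeDir timeDir < 0 := fun ζ =>
    S.timelike_timeDir _ (hV (hmem _))
  refine ⟨fun ζ => hmem _, hsm, ?_, fun ζ => ?_, fun ζ => ?_⟩
  · refine Function.LeftInverse.isEmbedding (f := fun p : Event => T⁻¹ * p.1) (fun ζ => ?_)
      (by fun_prop) hsm.continuous
    simp only [restMachine]
    field_simp
  · rw [(hasDerivAt_restMachine T x ζ).deriv]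
    simp only [map_smul, smul_apply, smul_eq_mul]
    have := hg ζ
    have h2 : 0 < T * T := mul_pos hT hT
    nlinarith
  · rw [(hasDerivAt_restMachine T x ζ).deriv]
    simp only [map_smul, smul_eq_mul]
    exact mul_neg_of_pos_of_neg hT (hg ζ)

theorem hasProperPeriod_restMachine {T f p : ℝ} {x : EuclideanSpace ℝ (Fin 3)}
    (hmetric : ∀ t, S.metric (t, x) timeDir timeDir = -f) (hp : √(T * (T * f)) = p) :
    S.HasProperPeriod (restMachine T x) p := by
  intro ζ
  have h1 : ∀ ζ, √(-(S.metric (restMachine T x ζ) (deriv (restMachine T x) ζ)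
      (deriv (restMachine T x) ζ))) = p := fun ζ => by
    rw [(hasDerivAt_restMachine T x ζ).deriv, ← hp]
    simp only [map_smul, smul_apply, smul_eq_mul, restMachine, hmetric]
    congr 1
    ring
  simp [properTime, h1]

end Spacetime

theorem phase_intCast (k : ℤ) : phase k = 0 := by
  have : ⌈(k : ℝ) - 1 / 2⌉ = k := by
    rw [Int.ceil_eq_iff]
    constructor <;> norm_num
  rw [phase, this, sub_self]

namespace Spacetime

section Channels

variable {S : Spacetime} {V : Set Event} {A B : ℝ → Event} {n : ℝ}

/-- A delay of exactly n readings both ways forces the partner's reading to be ζ − n for reception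
and ζ + n for emission; `huniq` then fixes the curve. -/
theorem uniquelyReached_of_delay
    (hAB : ∀ r r' c, S.IsNullGeodesic V c (A r) (B r') → r' = r + n)
    (hBA : ∀ r r' c, S.IsNullGeodesic V c (B r) (A r') → r' = r + n)
    (hexAB : ∀ r, ∃ c, S.IsNullGeodesic V c (A r) (B (r + n)))
    (hexBA : ∀ r, ∃ c, S.IsNullGeodesic V c (B r) (A (r + n)))
    (huniq : ∀ p p' c c', S.IsNullGeodesic V c p p' → S.IsNullGeodesic V c' p p' →
      EqOn c c' (Icc 0 1)) (U : Set Event) : S.UniquelyReached V U A B := by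
  intro ζ _
  constructor
  · obtain ⟨c, hc⟩ := hexBA (ζ - n)
    rw [sub_add_cancel] at hc
    refine ⟨ζ - n, c, hc, fun η' c' hc' => ?_⟩
    obtain rfl : η' = ζ - n := by linarith [hBA _ _ _ hc']
    exact ⟨rfl, huniq _ _ _ _ hc' hc⟩
  · obtain ⟨c, hc⟩ := hexAB ζ
    refine ⟨ζ + n, c, hc, fun η' c' hc' => ?_⟩
    obtain rfl : η' = ζ + n := hAB _ _ _ hc'
    exact ⟨rfl, huniq _ _ _ _ hc' hc⟩

theorem signalReadings_of_delay (hAB : ∀ r r' c, S.IsNullGeodesic V c (A r) (B r') → r' = r + n)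
    (hexAB : ∀ r, ∃ c, S.IsNullGeodesic V c (A r) (B (r + n))) :
    S.signalReadings V A B = {r | r.2 = r.1 + n} := by
  ext ⟨r, r'⟩
  constructor
  · rintro ⟨c, hc⟩
    exact hAB _ _ _ hc
  · intro (h : r' = r + n)
    rw [h]
    exact hexAB r

theorem preservesOrder_of_delay (h : S.signalReadings V A B = {r | r.2 = r.1 + n}) :
    PreservesOrder (S.signalReadings V A B) := by
  rw [h]
  intro r hr r' hr' hlt
  rw [mem_ofPred_eq] at hr hr'
  linarith

theorem tickChannel_of_delay (h : S.signalReadings V A B = {r | r.2 = r.1 + n}) :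
    S.tickChannel V A B = {r | ∃ k : ℤ, r = ((k : ℝ), (k : ℝ) + n)} := by
  ext ⟨r, r'⟩
  rw [tickChannel, h]
  constructor
  · rintro ⟨h1, h2⟩
    refine ⟨⌈r - 1 / 2⌉, ?_⟩
    -- Null phase means that the reading equals its own cycle count.
    have h3 : r = ⌈r - 1 / 2⌉ := sub_eq_zero.1 h2
    have h4 : r' = r + n := h1
    rw [h4, ← h3]
  · rintro ⟨k, hk⟩
    obtain ⟨rfl, rfl⟩ := Prod.mk.inj hk
    exact ⟨rfl, phase_intCast k⟩

/-- A reply sent at b' ≥ m + n arrives at b' + n, so the earliest echo is that of the immediate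
reply. -/
theorem hasEchoCount_of_delay (h : S.signalReadings V A B = {r | r.2 = r.1 + n})
    (h' : S.signalReadings V B A = {r | r.2 = r.1 + n}) (m : ℝ) :
    S.HasEchoCount V A B m (2 * n) := by
  refine ⟨m + n, by rw [h]; rfl, ?_, ?_⟩
  · refine ⟨m + n, le_rfl, ?_⟩
    rw [h', mem_ofPred_eq]
    ring
  · rintro a ⟨b', hb', hr⟩
    rw [h', mem_ofPred_eq] at hr
    linarith

end Channels

end Spacetime

theorem hasNullPhases_of_delay {n : ℕ} {C : Set (ℝ × ℝ)}
    (hC : C = {r | ∃ k : ℤ, r = ((k : ℝ), (k : ℝ) + n)}) : HasNullPhases C := by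
  rw [hC]
  rintro _ ⟨k, rfl⟩
  exact ⟨phase_intCast k, by simpa using phase_intCast (k + n)⟩

theorem affineIndependent_add_smul {ι E : Type*} [NormedAddCommGroup E] [NormedSpace ℝ E]
    {X : ι → E} (hX : AffineIndependent ℝ X) (x₀ : E) {R : ℝ} (hR : R ≠ 0) :
    AffineIndependent ℝ fun i => x₀ + R • X i :=
  hX.map' ((AffineMap.const ℝ E x₀ : E →ᵃ[ℝ] E) + (R • AffineMap.id ℝ E : E →ᵃ[ℝ] E))
    fun y y' hyy => by
      simpa [hR] using hyy

end

/-! ### Choice of the tetrahedron and of the clock rate -/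

theorem mainTheorem2 :
    ∃ ε : ℝ, 0 < ε ∧
      ∀ (S : Spacetime), S.IsStatic →
      ∀ (x₀ : EuclideanSpace ℝ (Fin 3)) (pτ : ℝ) (N : ℕ), 0 < pτ → 0 < N →
      ∀ (V : Set Event), V = worldTube x₀ (2 * (N * pτ)) →
      S.IsGentlyCurved V (N * pτ) ε →
      ∃ (γ : Fin 4 → ℝ → Event) (x : Fin 4 → EuclideanSpace ℝ (Fin 3)),
        (∀ i, S.IsOpenMachine V (γ i)) ∧
        S.HasProperPeriod (γ 0) pτ ∧
        (∀ i ζ, (γ i ζ).2 = x i) ∧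
        x 0 = x₀ ∧
        AffineIndependent ℝ x ∧
        ∀ i j : Fin 4, i ≠ j →
          S.RadarLinkable V V (γ i) (γ j) ∧
          PreservesOrder (S.signalReadings V (γ i) (γ j)) ∧
          S.tickChannel V (γ i) (γ j) = {r | ∃ k : ℤ, r = ((k : ℝ), (k : ℝ) + N)} ∧
          HasNullPhases (S.tickChannel V (γ i) (γ j)) ∧
          ∀ m : ℤ, S.HasEchoCount V (γ i) (γ j) m (2 * N) := by
  obtain ⟨δ, hδ, htetra⟩ := exists_regular_tetrahedron
  -- The first bound serves the theory of rays; the second keeps the deviation 3000000ε of Θ within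
  -- the tolerance δ of the tetrahedron.
  refine ⟨min (1 / 1000000) (δ / 3000000), by positivity, ?_⟩
  intro S hS x₀ pτ N hp hN V hVdef hV
  subst hVdef
  set ε := min (1 / 1000000) (δ / 3000000) with hεdef
  have hε : ε ≤ 1 / 1000000 := min_le_left _ _
  have hεδ : 3000000 * ε ≤ δ := by linarith [min_le_right (1 / 1000000) (δ / 3000000)]
  have hN' : (0 : ℝ) < N := Nat.cast_pos.2 hN
  obtain ⟨R, hRdef⟩ : ∃ R : ℝ, R = N * pτ := ⟨_, rfl⟩
  rw [← hRdef] at hV ⊢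
  have hR : 0 < R := hRdef ▸ mul_pos hN' hp
  have hflat := Spacetime.nearlyFlat hR hV
  have hε0 := hflat.eps_nonneg
  obtain ⟨Θ, hΘ, hsymm, hBL⟩ := hflat.exists_travelTimeSq hε
  have h0mem : (0 : EuclideanSpace ℝ (Fin 3)) ∈ Metric.ball (0 : EuclideanSpace ℝ (Fin 3)) 2 :=
    Metric.mem_ball_self (by norm_num)
  set f₀ := S.lapseSq x₀ R 0 with hf₀
  have hf₀pos : 0 < f₀ := hflat.lapse_pos (by linarith) h0mem
  -- The links need R√ℓ = N·T and the first clock needs T√f₀ = pτ. With R = N·pτ this forces ℓ =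
  -- 1/f₀, which is within 2ε of 1.
  obtain ⟨X, hX0, hXn, hXaff, hXΘ⟩ := htetra Θ hsymm (hBL.mono hεδ) f₀⁻¹
    ((hflat.abs_inv_lapse_sub_one_le (by linarith) h0mem).trans (by linarith))
  set T := pτ * √(f₀⁻¹) with hT
  have hTpos : 0 < T := mul_pos hp (Real.sqrt_pos.2 (inv_pos.2 hf₀pos))
  have hRT : R * √(f₀⁻¹) = T * N := by rw [hRdef, hT]; ring
  have hmem : ∀ i t, (t, x₀ + R • X i) ∈ worldTube x₀ (2 * R) := fun i t =>
    Spacetime.mem_worldTube hR (by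
      rw [mem_ball_zero_iff]; exact (hXn i).trans (by norm_num)) t
  have hsig : ∀ i j, i ≠ j → ∀ r r' c, S.IsNullGeodesic (worldTube x₀ (2 * R)) c
      (Spacetime.restMachine T (x₀ + R • X i) r) (Spacetime.restMachine T (x₀ + R • X j) r') →
      r' = r + N := fun i j hij r r' c hc => by
    have h1 := hc.time_eq hR hV hS hε hΘ (hXn i) (hXn j)
    rw [hXΘ i j hij, hRT, ← mul_add] at h1
    exact mul_left_cancel₀ hTpos.ne' h1
  have hex : ∀ i j, i ≠ j → ∀ r, ∃ c, S.IsNullGeodesic (worldTube x₀ (2 * R)) c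
      (Spacetime.restMachine T (x₀ + R • X i) r)
      (Spacetime.restMachine T (x₀ + R • X j) (r + N)) := fun i j hij r => by
    have h1 := Spacetime.exists_isNullGeodesic hR hV hS hε hΘ (hXn i) (hXn j)
      (hXaff.injective.ne hij) (T * r)
    rwa [hXΘ i j hij, hRT, ← mul_add] at h1
  have huniq : ∀ p p' c c', S.IsNullGeodesic (worldTube x₀ (2 * R)) c p p' →
      S.IsNullGeodesic (worldTube x₀ (2 * R)) c' p p' → EqOn c c' (Icc 0 1) :=
    fun p p' c c' hc hc' => hc.eqOn hR hV hS hε hc'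
  have hread := fun i j hij => Spacetime.signalReadings_of_delay (hsig i j hij) (hex i j hij)
  refine ⟨fun i => Spacetime.restMachine T (x₀ + R • X i), fun i => x₀ + R • X i,
    fun i => Spacetime.isOpenMachine_restMachine hTpos (hmem i) hV.1,
    Spacetime.hasProperPeriod_restMachine (f := f₀) (fun t => ?_) ?_, fun i ζ => rfl, by simp [hX0],
    affineIndependent_add_smul hXaff x₀ hR.ne', fun i j hij =>
    ⟨⟨Spacetime.uniquelyReached_of_delay (hsig i j hij) (hsig j i hij.symm) (hex i j hij)
        (hex j i hij.symm) huniq _,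
      Spacetime.uniquelyReached_of_delay (hsig j i hij.symm) (hsig i j hij) (hex j i hij.symm)
        (hex i j hij) huniq _⟩,
      Spacetime.preservesOrder_of_delay (hread i j hij),
      Spacetime.tickChannel_of_delay (hread i j hij),
      hasNullPhases_of_delay (Spacetime.tickChannel_of_delay (hread i j hij)),
      fun m => Spacetime.hasEchoCount_of_delay (hread i j hij) (hread j i hij.symm) m⟩⟩
  · rw [hX0, Spacetime.metric_apply hR hV hS h0mem]
    simp [timeDir, hf₀]
  · have h1 : T * (T * f₀) = pτ ^ 2 := by
      have h2 : √(f₀⁻¹) * √(f₀⁻¹) = f₀⁻¹ := Real.mul_self_sqrt (inv_pos.2 hf₀pos).le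
      calc T * (T * f₀) = pτ ^ 2 * (√(f₀⁻¹) * √(f₀⁻¹)) * f₀ := by rw [hT]; ring
        _ = pτ ^ 2 := by rw [h2]; field_simp
    rw [h1, Real.sqrt_sq hp.le]
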